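/- There exist functions $\gamma\colon\mathbb N\to\mathbb N$ and $c\colon\mathbb N\to(0,\infty)$, a single algorithm and a polynomial $p$ such that the following holds for all $d,n\in\mathbb N$, every (finite, simple, undirected) graph $G$ on $n$ vertices of maximum degree at most $d$, and every integer $r$ with $1\le r\le c(d)\sqrt n$ (in particular, for every fixed $d$ and every integer function $r=r(n)\ge 1$ with $r=o(\sqrt n)$, for all sufficiently large $n$). On input $(G,r)$ the algorithm outputs an instance of List Graph Homomorphism, that is, two graphs $G'$ and $H'$ together with a list $\mathcal L(v)\subseteq V(H')$ for every $v\in V(G')$, such that 1. $G$ is 3-colorable if and only if there is a graph homomorphism $\varphi\colon G'\to H'$ with $\varphi(v)\in\mathcal L(v)$ for all $v\in V(G')$; 2. $|V(G')|\le \dfrac{n}{r}$ and $|V(H')|\le\gamma(d)^r$; 3. the running time is polynomial in the size of the input and of the output: the algorithm stops after at most $p\bigl(n+|V(H')|\bigr)$ steps on a random access machine, on which reading or writing memory, addition, subtraction and comparison of natural numbers cost one step each, and graphs and lists are given by their adjacency and incidence matrices. In particular the running time is at most $p\bigl(n+\gamma(d)^r\bigr)$, which for fixed $d$ and $r=O(\log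 n)$ is polynomial in $n$. -/

import Mathlib

/-! ### A random access machine with a step count

Programs act on finitely many registers and finitely many arrays, all of whose entries are natural
numbers. An array cell is addressed by a pair of natural numbers. The elementary operations are
constants, reading a register or a cell, addition, truncated subtraction and comparison, and every
elementary operation costs one step. There is no multiplication, so after `t` steps all numbers have
at most `O(t)` more bits than those of the input, and time is polynomially related to the time of a
Turing machine. -/

/-- A memory configuration: register `x` holds `reg x`, and cell `(i, j)` of array `a` holds
`arr a i j`. -/
structure RamState where
  reg : ℕ → ℕ
  arr : ℕ → ℕ → ℕ → ℕ

/-- Expressions; truth values are `1` and `0`. -/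
inductive RamExpr : Type where
  | const (k : ℕ)
  | reg (x : ℕ)
  | get (a : ℕ) (i j : RamExpr)
  | add (e f : RamExpr)
  | sub (e f : RamExpr)
  | lt (e f : RamExpr)
  | eq (e f : RamExpr)

namespace RamExpr

/-- The value of an expression in a given memory. -/
def eval (s : RamState) : RamExpr → ℕ
  | const k => k
  | reg x => s.reg x
  | get a i j => s.arr a (eval s i) (eval s j)
  | add e f => eval s e + eval s f
  | sub e f => eval s e - eval s f
  | lt e f => if eval s e < eval s f then 1 else 0
  | eq e f => if eval s e = eval s f then 1 else 0

/-- The number of steps needed to evaluate an expression: one for every operation in it. -/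
def cost : RamExpr → ℕ
  | const _ => 1
  | reg _ => 1
  | get _ i j => cost i + cost j + 1
  | add e f => cost e + cost f + 1
  | sub e f => cost e + cost f + 1
  | lt e f => cost e + cost f + 1
  | eq e f => cost e + cost f + 1

end RamExpr

namespace RamState

/-- Write `v` into register `x`. -/
def setReg (s : RamState) (x v : ℕ) : RamState where
  reg := fun y => if y = x then v else s.reg y
  arr := s.arr

/-- Write `v` into cell `(i, j)` of array `a`. -/
def setArr (s : RamState) (a i j v : ℕ) : RamState where
  reg := s.reg
  arr := fun b k l => if b = a ∧ k = i ∧ l = j then v else s.arr b k l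

end RamState

/-- Programs. -/
inductive RamProg : Type where
  | skip
  | assign (x : ℕ) (e : RamExpr)
  | store (a : ℕ) (i j e : RamExpr)
  | seq (P Q : RamProg)
  | ite (e : RamExpr) (P Q : RamProg)
  | loop (e : RamExpr) (P : RamProg)

/-- `P.Runs s t s'`: started in memory `s`, the program `P` halts after exactly `t` steps in memory
`s'`. Here `ite e P Q` executes `P` if `e` is nonzero and `Q` otherwise, and `loop e P` executes `P`
as long as `e` is nonzero. -/
inductive RamProg.Runs : RamProg → RamState → ℕ → RamState → Prop where
  | skip (s : RamState) : Runs RamProg.skip s 1 s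
  | assign (x : ℕ) (e : RamExpr) (s : RamState) :
      Runs (RamProg.assign x e) s (e.cost + 1) (s.setReg x (e.eval s))
  | store (a : ℕ) (i j e : RamExpr) (s : RamState) :
      Runs (RamProg.store a i j e) s (i.cost + j.cost + e.cost + 1)
        (s.setArr a (i.eval s) (j.eval s) (e.eval s))
  | seq {P Q : RamProg} {s₁ s₂ s₃ : RamState} {t u : ℕ} :
      Runs P s₁ t s₂ → Runs Q s₂ u s₃ → Runs (RamProg.seq P Q) s₁ (t + u) s₃
  | ite_true {e : RamExpr} {P Q : RamProg} {s₁ s₂ : RamState} {t : ℕ} :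
      e.eval s₁ ≠ 0 → Runs P s₁ t s₂ → Runs (RamProg.ite e P Q) s₁ (e.cost + 1 + t) s₂
  | ite_false {e : RamExpr} {P Q : RamProg} {s₁ s₂ : RamState} {t : ℕ} :
      e.eval s₁ = 0 → Runs Q s₁ t s₂ → Runs (RamProg.ite e P Q) s₁ (e.cost + 1 + t) s₂
  | loop_done {e : RamExpr} {P : RamProg} {s : RamState} :
      e.eval s = 0 → Runs (RamProg.loop e P) s (e.cost + 1) s
  | loop_step {e : RamExpr} {P : RamProg} {s₁ s₂ s₃ : RamState} {t u : ℕ} :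
      e.eval s₁ ≠ 0 → Runs P s₁ t s₂ → Runs (RamProg.loop e P) s₂ u s₃ →
        Runs (RamProg.loop e P) s₁ (e.cost + 1 + t + u) s₃

/-! ### List homomorphism and the representation of inputs and outputs -/

/-- An instance of the list homomorphism problem: a source graph, a target graph, and for every
vertex of the source a list of allowed images in the target. -/
structure ListHomInstance where
  /-- number of vertices of the source graph -/
  srcCard : ℕ
  /-- number of vertices of the target graph -/
  tgtCard : ℕ
  src : SimpleGraph (Fin srcCard)
  tgt : SimpleGraph (Fin tgtCard)
  lists : Fin srcCard → Set (Fin tgtCard)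

/-- There is a homomorphism that respects the lists. -/
def ListHomInstance.Satisfiable (I : ListHomInstance) : Prop :=
  ∃ φ : I.src →g I.tgt, ∀ v, φ v ∈ I.lists v

/-- The initial memory for the input `(G, r)`: register `0` holds the number `n` of vertices,
register `1` holds `r`, array `0` holds the adjacency matrix of `G`, and all else is `0`. -/
def inputState {n : ℕ} (G : SimpleGraph (Fin n)) [DecidableRel G.Adj] (r : ℕ) : RamState where
  reg := fun x => if x = 0 then n else if x = 1 then r else 0
  arr := fun a i j =>
    if a = 0 then
      if h : i < n ∧ j < n then
        if G.Adj ⟨i, h.1⟩ ⟨j, h.2⟩ then 1 else 0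
      else 0
    else 0

/-- The memory `s` holds the instance `I`: registers `2` and `3` hold the numbers of vertices of the
source and of the target, array `1` holds the adjacency matrix of the source, array `2` that of
the target, and array `3` the incidence matrix of the lists. -/
structure RamState.Holds (s : RamState) (I : ListHomInstance) : Prop where
  srcCard : s.reg 2 = I.srcCard
  tgtCard : s.reg 3 = I.tgtCard
  src : ∀ u v : Fin I.srcCard, s.arr 1 u v ≠ 0 ↔ I.src.Adj u v
  tgt : ∀ a b : Fin I.tgtCard, s.arr 2 a b ≠ 0 ↔ I.tgt.Adj a b
  lists : ∀ (u : Fin I.srcCard) (a : Fin I.tgtCard), s.arr 3 u a ≠ 0 ↔ a ∈ I.lists u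

/-!
The vertices of `G` are grouped into `k = n / r` buckets, which become the vertices of the source
graph. Bucket `b` carries the label `b % L`, where the number `L = 24 (D + 1)² r` of labels is linear
in `r` (`D` is the maximum degree). The grouping is such that every bucket has at most one edge of `G`
to the buckets of any one label (`IsGrouping`). So a 3-colouring of a bucket can be communicated to
its neighbours as a function from the labels to the three colours: the value at `l` is the colour of
the only vertex of the bucket that has a neighbour in a bucket with label `l`. The target vertices are
the pairs of a label and such a function, of which there are `9 ^ L` in a convenient (redundant)
encoding by ternary digits, and two of them are adjacent if the colours that they show to each other
differ. The list of a bucket fixes its label and demands that all values that belong to the same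
vertex of `G` are equal. A list homomorphism is then the same thing as a 3-colouring
(`colorable_three_iff_satisfiable`).

The grouping is found greedily: labels are attached to the buckets in advance, and each vertex goes to
the first bucket that preserves the invariant. A fixed vertex is excluded from `O(D² r)` labels or
buckets of the same label, that is, from `O(D² r (k / L + 1))` buckets, and from the at most
`n / (2 r)` full ones; this is fewer than `k` if `n ≥ 64 (D + 1)² r²` (`IsGrouping.exists_fits`,
`bucket_count_lt`).

For the running time, the program is written in a small language of commands over expressions with
bounded sums. In it, programs are total functions on memories (`Cmd.exec`), bounded quantifiers,
products and quotients are sums, and since all sums and loops are bounded by `n` or by the number of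
target vertices, the compiled program is polynomial for syntactic reasons (`Cmd.compile_runs`).
-/

/-! ### Expressions with bounded sums -/

/-- The binary operations of the machine. -/
inductive BinOp : Type where
  | add | sub | lt | eq

namespace BinOp

/-- The machine expression that applies the operation to two registers. -/
def toRam : BinOp → ℕ → ℕ → RamExpr
  | add, x, y => .add (.reg x) (.reg y)
  | sub, x, y => .sub (.reg x) (.reg y)
  | lt, x, y => .lt (.reg x) (.reg y)
  | eq, x, y => .eq (.reg x) (.reg y)

/-- The value of the operation; truth values are `1` and `0`. -/
def eval : BinOp → ℕ → ℕ → ℕ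
  | add, a, b => a + b
  | sub, a, b => a - b
  | lt, a, b => if a < b then 1 else 0
  | eq, a, b => if a = b then 1 else 0

theorem eval_toRam (o : BinOp) (s : RamState) (x y : ℕ) :
    (o.toRam x y).eval s = o.eval (s.reg x) (s.reg y) := by
  cases o <;> rfl

theorem cost_toRam (o : BinOp) (x y : ℕ) : (o.toRam x y).cost = 3 := by
  cases o <;> rfl

end BinOp

namespace RamState

@[simp] theorem reg_setReg (s : RamState) (x v y : ℕ) :
    (s.setReg x v).reg y = if y = x then v else s.reg y := rfl

@[simp] theorem arr_setReg (s : RamState) (x v : ℕ) : (s.setReg x v).arr = s.arr := rfl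

@[simp] theorem reg_setArr (s : RamState) (a i j v : ℕ) : (s.setArr a i j v).reg = s.reg := rfl

@[simp] theorem arr_setArr (s : RamState) (a i j v b k l : ℕ) :
    (s.setArr a i j v).arr b k l = if b = a ∧ k = i ∧ l = j then v else s.arr b k l := rfl

/-- Two memories agree on all arrays and on the registers below `k`. -/
structure AgreeBelow (k : ℕ) (s s' : RamState) : Prop where
  reg : ∀ z < k, s'.reg z = s.reg z
  arr : s'.arr = s.arr

theorem AgreeBelow.refl (k : ℕ) (s : RamState) : AgreeBelow k s s := ⟨fun _ _ => rfl, rfl⟩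

theorem AgreeBelow.trans {k : ℕ} {s s' s'' : RamState} (h : AgreeBelow k s s')
    (h' : AgreeBelow k s' s'') : AgreeBelow k s s'' :=
  ⟨fun z hz => (h'.reg z hz).trans (h.reg z hz), h'.arr.trans h.arr⟩

theorem AgreeBelow.mono {k l : ℕ} {s s' : RamState} (h : AgreeBelow l s s') (hkl : k ≤ l) :
    AgreeBelow k s s' :=
  ⟨fun z hz => h.reg z (hz.trans_le hkl), h.arr⟩

theorem AgreeBelow.setReg_right {k : ℕ} {s s' : RamState} (h : AgreeBelow k s s') {x : ℕ}
    (hx : k ≤ x) (v : ℕ) : AgreeBelow k s (s'.setReg x v) :=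
  ⟨fun z hz => by simp [h.reg z hz, (hz.trans_le hx).ne], h.arr⟩

theorem AgreeBelow.setReg {k : ℕ} {s s' : RamState} (h : AgreeBelow k s s') (x v : ℕ) :
    AgreeBelow k (s.setReg x v) (s'.setReg x v) :=
  ⟨fun z hz => by simp [h.reg z hz], h.arr⟩

end RamState

/-- A loop whose counter runs from its present value to the value of a register terminates, with a
linear overhead; `Inv i` is the loop invariant after `i` rounds. -/
theorem RamProg.runs_loop {x y n T : ℕ} {body : RamProg} (Inv : ℕ → RamState → Prop)
    (hx : ∀ i s, Inv i s → s.reg x = i ∧ s.reg y = n)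
    (h : ∀ i < n, ∀ s, Inv i s → ∃ t s', body.Runs s t s' ∧ Inv (i + 1) s' ∧ t ≤ T)
    (s : RamState) (h0 : Inv 0 s) :
    ∃ t s', (RamProg.loop (.lt (.reg x) (.reg y)) body).Runs s t s' ∧ Inv n s' ∧
      t ≤ n * (T + 4) + 4 := by
  have key : ∀ m i, i + m = n → ∀ s, Inv i s →
      ∃ t s', (RamProg.loop (.lt (.reg x) (.reg y)) body).Runs s t s' ∧ Inv n s' ∧
        t ≤ m * (T + 4) + 4 := by
    intro m
    induction m with
    | zero =>
      intro i hi s hs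
      obtain rfl : i = n := by omega
      have := hx i s hs
      exact ⟨_, s, .loop_done (by simp [RamExpr.eval, this]), hs, by simp [RamExpr.cost]⟩
    | succ m ih =>
      intro i hi s hs
      have hlt : i < n := by omega
      have hv := hx i s hs
      obtain ⟨t, s', hr, hI, ht⟩ := h i hlt s hs
      obtain ⟨u, s'', hr', hI', hu⟩ := ih (i + 1) (by omega) s' hI
      refine ⟨_, s'', .loop_step (by simp [RamExpr.eval, hv, hlt]) hr hr', hI', ?_⟩
      have : (m + 1) * (T + 4) = m * (T + 4) + (T + 4) := by ring
      simp only [RamExpr.cost]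
      omega
  exact key n 0 (by omega) s h0

/-- Expressions over named registers that, beyond the machine operations, have a conditional and the
bounded sum `sum x y e = ∑ i < reg y, e[x := i]`. -/
inductive SumExpr : Type where
  | const (k : ℕ)
  | reg (x : ℕ)
  | get (a : ℕ) (i j : SumExpr)
  | bin (o : BinOp) (e f : SumExpr)
  | ite (c e f : SumExpr)
  | sum (x y : ℕ) (e : SumExpr)

namespace SumExpr

/-- The value of an expression in a given memory. -/
def eval (s : RamState) : SumExpr → ℕ
  | const k => k
  | reg x => s.reg x
  | get a i j => s.arr a (eval s i) (eval s j)
  | bin o e f => o.eval (eval s e) (eval s f)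
  | ite c e f => if eval s c = 0 then eval s f else eval s e
  | sum x y e => ∑ i ∈ Finset.range (s.reg y), eval (s.setReg x i) e

/-- The named registers are those below `20`; the compiled code keeps its intermediate results in
the registers from `20` on. Sums are bounded by register `0` or `3`, which hold the numbers of
vertices of the input and of the target graph, so that their lengths are polynomially bounded. -/
def wf : SumExpr → Bool
  | const _ => true
  | reg x => x < 20
  | get _ i j => wf i && wf j
  | bin _ e f => wf e && wf f
  | ite c e f => wf c && wf e && wf f
  | sum x y e => x < 20 && x ≠ 0 && x ≠ 3 && (y == 0 || y == 3) && wf e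

/-- Code that evaluates the expression into register `k` and otherwise changes only registers
above `k`. The old value of a summation variable is saved and restored. -/
def compile (k : ℕ) : SumExpr → RamProg
  | const c => .assign k (.const c)
  | reg x => .assign k (.reg x)
  | get a i j => .seq (compile k i) (.seq (compile (k + 1) j)
      (.assign k (.get a (.reg k) (.reg (k + 1)))))
  | bin o e f => .seq (compile k e) (.seq (compile (k + 1) f)
      (.assign k (o.toRam k (k + 1))))
  | ite c e f => .seq (compile k c) (.ite (.reg k) (compile k e) (compile k f))
  | sum x y e => .seq (.assign k (.const 0)) (.seq (.assign (k + 1) (.reg x))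
      (.seq (.assign x (.const 0))
        (.seq (.loop (.lt (.reg x) (.reg y)) (.seq (compile (k + 2) e)
            (.seq (.assign k (.add (.reg k) (.reg (k + 2)))) (.assign x (.add (.reg x) (.const 1))))))
          (.assign x (.reg (k + 1))))))

/-- A bound for the evaluation time, as a polynomial in a common bound of the registers `0`
and `3`. -/
noncomputable def cost : SumExpr → Polynomial ℕ
  | const _ => 2
  | reg _ => 2
  | get _ i j => cost i + cost j + 4
  | bin _ e f => cost e + cost f + 4
  | ite c e f => cost c + cost e + cost f + 2
  | sum _ _ e => Polynomial.X * (cost e + 12) + 12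

theorem eval_congr {e : SumExpr} (he : e.wf) {s s' : RamState} (h : s.AgreeBelow 20 s') :
    e.eval s' = e.eval s := by
  induction e generalizing s s' with
  | const k => rfl
  | reg x => exact h.reg x (by simpa [wf] using he)
  | get a i j hi hj =>
    simp only [wf, Bool.and_eq_true] at he
    simp [eval, hi he.1 h, hj he.2 h, h.arr]
  | bin o e f hi hj =>
    simp only [wf, Bool.and_eq_true] at he
    simp [eval, hi he.1 h, hj he.2 h]
  | ite c e f hc hi hj =>
    simp only [wf, Bool.and_eq_true] at he
    simp [eval, hc he.1.1 h, hi he.1.2 h, hj he.2 h]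
  | sum x y e ih =>
    simp only [wf, Bool.and_eq_true, Bool.or_eq_true, beq_iff_eq] at he
    have hy : s'.reg y = s.reg y := h.reg y (by omega)
    simp only [eval, hy]
    exact Finset.sum_congr rfl fun i _ => ih he.2 (h.setReg x i)

/-- The compiled code evaluates the expression, within the bounds for time and for the part of the
memory that it changes. -/
theorem compile_runs {e : SumExpr} (he : e.wf) {k : ℕ} (hk : 20 ≤ k) (s : RamState) {N : ℕ}
    (h0 : s.reg 0 ≤ N) (h3 : s.reg 3 ≤ N) :
    ∃ t s', (e.compile k).Runs s t s' ∧ s'.reg k = e.eval s ∧ s.AgreeBelow k s' ∧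
      t ≤ e.cost.eval N := by
  induction e generalizing s k with
  | const c =>
    exact ⟨_, _, .assign _ _ _, by simp [eval, RamExpr.eval],
      (RamState.AgreeBelow.refl k s).setReg_right le_rfl _, by simp [cost, RamExpr.cost]⟩
  | reg x =>
    exact ⟨_, _, .assign _ _ _, by simp [eval, RamExpr.eval],
      (RamState.AgreeBelow.refl k s).setReg_right le_rfl _, by simp [cost, RamExpr.cost]⟩
  | get a i j hi hj =>
    simp only [wf, Bool.and_eq_true] at he
    obtain ⟨t, s', hr, hv, ha, ht⟩ := hi he.1 hk s h0 h3
    obtain ⟨u, s'', hr', hv', ha', hu⟩ := hj he.2 (k := k + 1) (by omega) s'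
      (by rwa [ha.reg 0 (by omega)]) (by rwa [ha.reg 3 (by omega)])
    refine ⟨_, _, .seq hr (.seq hr' (.assign _ _ _)), ?_,
      (ha.trans (ha'.mono (by omega))).setReg_right le_rfl _, ?_⟩
    · simp [eval, RamExpr.eval, hv', ha'.reg k (by omega), hv, ha'.arr, ha.arr,
        eval_congr he.2 (ha.mono hk)]
    · simp [cost, RamExpr.cost]; omega
  | bin o i j hi hj =>
    simp only [wf, Bool.and_eq_true] at he
    obtain ⟨t, s', hr, hv, ha, ht⟩ := hi he.1 hk s h0 h3
    obtain ⟨u, s'', hr', hv', ha', hu⟩ := hj he.2 (k := k + 1) (by omega) s'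
      (by rwa [ha.reg 0 (by omega)]) (by rwa [ha.reg 3 (by omega)])
    refine ⟨_, _, .seq hr (.seq hr' (.assign _ _ _)), ?_,
      (ha.trans (ha'.mono (by omega))).setReg_right le_rfl _, ?_⟩
    · simp [eval, BinOp.eval_toRam, hv', ha'.reg k (by omega), hv,
        eval_congr he.2 (ha.mono hk)]
    · simp [cost, BinOp.cost_toRam]; omega
  | ite c i j hc hi hj =>
    simp only [wf, Bool.and_eq_true] at he
    obtain ⟨t, s', hr, hv, ha, ht⟩ := hc he.1.1 hk s h0 h3
    have h0' : s'.reg 0 ≤ N := by rwa [ha.reg 0 (by omega)]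
    have h3' : s'.reg 3 ≤ N := by rwa [ha.reg 3 (by omega)]
    by_cases h : c.eval s = 0
    · obtain ⟨u, s'', hr', hv', ha', hu⟩ := hj he.2 hk s' h0' h3'
      refine ⟨_, _, .seq hr (.ite_false (by simp [RamExpr.eval, hv, h]) hr'), ?_,
        ha.trans ha', ?_⟩
      · simp [eval, h, hv', eval_congr he.2 (ha.mono hk)]
      · simp [cost, RamExpr.cost]; omega
    · obtain ⟨u, s'', hr', hv', ha', hu⟩ := hi he.1.2 hk s' h0' h3'
      refine ⟨_, _, .seq hr (.ite_true (by simp [RamExpr.eval, hv, h]) hr'), ?_,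
        ha.trans ha', ?_⟩
      · simp [eval, h, hv', eval_congr he.1.2 (ha.mono hk)]
      · simp [cost, RamExpr.cost]; omega
  | sum x y e ih =>
    simp only [wf, Bool.and_eq_true, Bool.or_eq_true, beq_iff_eq, decide_eq_true_eq] at he
    obtain ⟨⟨⟨⟨hx, hx0⟩, hx3⟩, hy⟩, hwe⟩ := he
    have hxy : y ≠ x := by rintro rfl; simp_all
    have hyN : s.reg y ≤ N := by rcases hy with rfl | rfl <;> assumption
    let Inv : ℕ → RamState → Prop := fun i s' =>
      (s.setReg x i).AgreeBelow k s' ∧ s'.reg (k + 1) = s.reg x ∧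
        s'.reg k = ∑ j ∈ Finset.range i, e.eval (s.setReg x j)
    obtain ⟨t, s', hr, ⟨hI1, hI2, hI3⟩, ht⟩ := RamProg.runs_loop (x := x) (y := y)
      (n := s.reg y) (T := e.cost.eval N + 8)
      (body := .seq (compile (k + 2) e) (.seq (.assign k (.add (.reg k) (.reg (k + 2))))
        (.assign x (.add (.reg x) (.const 1)))))
      Inv (fun i s' h => ⟨by simp [h.1.reg x (by omega)], by simp [h.1.reg y (by omega), hxy]⟩)
      (by
        rintro i hi s' ⟨h1, h2, h3'⟩
        obtain ⟨t, s'', hr, hv, ha, ht⟩ := ih hwe (k := k + 2) (by omega) s'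
          (by rw [h1.reg 0 (by omega)]; simpa [Ne.symm hx0] using h0)
          (by rw [h1.reg 3 (by omega)]; simpa [Ne.symm hx3] using h3)
        have hkx : k ≠ x := by omega
        have hkx' : k + 1 ≠ x := by omega
        refine ⟨_, _, .seq hr (.seq (.assign _ _ _) (.assign _ _ _)), ⟨⟨fun z hz => ?_, ?_⟩, ?_, ?_⟩,
          ?_⟩
        · have hzk : z ≠ k := by omega
          have hxk : x ≠ k := by omega
          by_cases hzx : z = x
          · subst hzx
            simp [RamExpr.eval, hzk, ha.reg z (by omega), h1.reg z hz]
          · simp [hzx, hzk, ha.reg z (by omega), h1.reg z hz]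
        · simp [ha.arr, h1.arr]
        · simp [hkx', ha.reg (k + 1) (by omega), h2]
        · simp [hkx, RamExpr.eval, ha.reg k (by omega), h3', hv, Finset.sum_range_succ,
            eval_congr hwe (h1.mono hk)]
        · simp only [RamExpr.cost]; omega)
      (((s.setReg k 0).setReg (k + 1) (s.reg x)).setReg x 0)
      (by
        have hkx : k ≠ x := by omega
        have hkx' : k + 1 ≠ x := by omega
        refine ⟨⟨fun z hz => ?_, rfl⟩, ?_, ?_⟩
        · have hzk : z ≠ k := by omega
          have hzk' : z ≠ k + 1 := by omega
          simp [hzk, hzk']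
        · simp [hkx']
        · simp [hkx])
    have hxk : x ≠ k := by omega
    refine ⟨_, s'.setReg x (s'.reg (k + 1)), .seq (.assign _ _ _) (.seq (.assign _ _ _)
      (.seq (.assign _ _ _) (.seq (t := t) ?_ (.assign _ _ _)))), ?_,
      ⟨fun z hz => ?_, hI1.arr⟩, ?_⟩
    · simpa [RamExpr.eval, hxk] using hr
    · simp [hI3, eval, Ne.symm hxk]
    · by_cases hzx : z = x
      · simp [hzx, hI2]
      · simp [hzx, hI1.reg z hz]
    · have : s.reg y * (e.cost.eval N + 8 + 4) ≤ N * (e.cost.eval N + 12) :=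
        Nat.mul_le_mul hyN le_rfl
      simp [cost, RamExpr.cost]; omega

end SumExpr

/-! ### Commands with bounded loops -/

/-- Commands: assignments, and loops in which the register `x` runs through all numbers below the
value of register `y`. -/
inductive Cmd : Type where
  | assign (x : ℕ) (e : SumExpr)
  | store (a : ℕ) (i j e : SumExpr)
  | seq (c d : Cmd)
  | forLoop (x y : ℕ) (c : Cmd)

namespace Cmd

/-- The memory after the execution of a command. -/
def exec : Cmd → RamState → RamState
  | assign x e, s => s.setReg x (e.eval s)
  | store a i j e, s => s.setArr a (i.eval s) (j.eval s) (e.eval s)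
  | seq c d, s => exec d (exec c s)
  | forLoop x y c, s =>
      Nat.rec (s.setReg x 0) (fun i s' => (exec c s').setReg x (i + 1)) (s.reg y)

/-- The registers that a command may change. -/
def writes (z : ℕ) : Cmd → Bool
  | assign x _ => x == z
  | store _ _ _ _ => false
  | seq c d => writes z c || writes z d
  | forLoop x _ c => x == z || writes z c

/-- Only named registers are used, loops do not change their counters, and the loop bounds, which
are the registers `0` and `3`, do not change. -/
def wf : Cmd → Bool
  | assign x e => x < 20 && x ≠ 0 && x ≠ 3 && e.wf
  | store _ i j e => i.wf && j.wf && e.wf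
  | seq c d => wf c && wf d
  | forLoop x y c => x < 20 && x ≠ 0 && x ≠ 3 && (y == 0 || y == 3) && !(writes x c) && wf c

/-- The code of a command. -/
def compile : Cmd → RamProg
  | assign x e => .seq (e.compile 20) (.assign x (.reg 20))
  | store a i j e => .seq (i.compile 20) (.seq (j.compile 21) (.seq (e.compile 22)
      (.store a (.reg 20) (.reg 21) (.reg 22))))
  | seq c d => .seq (compile c) (compile d)
  | forLoop x y c => .seq (.assign x (.const 0)) (.loop (.lt (.reg x) (.reg y))
      (.seq (compile c) (.assign x (.add (.reg x) (.const 1)))))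

/-- A bound for the running time, as a polynomial in a common bound of the registers `0` and
`3`. -/
noncomputable def cost : Cmd → Polynomial ℕ
  | assign _ e => e.cost + 2
  | store _ i j e => i.cost + j.cost + e.cost + 4
  | seq c d => cost c + cost d
  | forLoop _ _ c => Polynomial.X * (cost c + 8) + 6

theorem exec_reg_of_not_writes {c : Cmd} {z : ℕ} (h : c.writes z = false) (s : RamState) :
    (c.exec s).reg z = s.reg z := by
  induction c generalizing s with
  | assign x e =>
    have : z ≠ x := by rintro rfl; simp [writes] at h
    simp [exec, this]
  | store a i j e => rfl
  | seq c d hc hd =>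
    simp only [writes, Bool.or_eq_false_iff] at h
    simp [exec, hc h.1, hd h.2]
  | forLoop x y c ih =>
    simp only [writes, Bool.or_eq_false_iff, beq_eq_false_iff_ne] at h
    have hz : z ≠ x := Ne.symm h.1
    simp only [exec]
    generalize s.reg y = n
    induction n with
    | zero => simp [hz]
    | succ n ihn => simp [hz, ih h.2, ihn]

theorem not_writes_bounds {c : Cmd} (h : c.wf) : c.writes 0 = false ∧ c.writes 3 = false := by
  induction c with
  | assign x e => simp_all [wf, writes]
  | store a i j e => simp [writes]
  | seq c d hc hd => simp_all [wf, writes]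
  | forLoop x y c ih => simp_all [wf, writes]

/-- Code for `x := e`; here `x` may be one of the registers that bound loops. -/
theorem assign_runs {e : SumExpr} (he : e.wf) {x : ℕ} (s₀ s : RamState)
    (hs : s₀.AgreeBelow 20 s) {N : ℕ} (h0 : s₀.reg 0 ≤ N) (h3 : s₀.reg 3 ≤ N) :
    ∃ t s', (compile (assign x e)).Runs s t s' ∧ (exec (assign x e) s₀).AgreeBelow 20 s' ∧
      t ≤ (cost (assign x e)).eval N := by
  obtain ⟨t, s', hr, hv, ha, ht⟩ := e.compile_runs he le_rfl s (N := N)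
    (by rwa [hs.reg 0 (by omega)]) (by rwa [hs.reg 3 (by omega)])
  refine ⟨_, _, .seq hr (.assign _ _ _), ?_, ?_⟩
  · simp only [RamExpr.eval, hv, e.eval_congr he hs, exec]
    exact (hs.trans ha).setReg _ _
  · simp [cost, RamExpr.cost, ht]

/-- The code of a command reaches the memory that `exec` prescribes, up to registers that are not
named, in polynomial time. -/
theorem compile_runs {c : Cmd} (hc : c.wf) (s₀ s : RamState) (hs : s₀.AgreeBelow 20 s) {N : ℕ}
    (h0 : s₀.reg 0 ≤ N) (h3 : s₀.reg 3 ≤ N) :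
    ∃ t s', c.compile.Runs s t s' ∧ (c.exec s₀).AgreeBelow 20 s' ∧ t ≤ c.cost.eval N := by
  induction c generalizing s₀ s with
  | assign x e =>
    simp only [wf, Bool.and_eq_true] at hc
    exact assign_runs hc.2 s₀ s hs h0 h3
  | store a i j e =>
    simp only [wf, Bool.and_eq_true] at hc
    have h0' : s.reg 0 ≤ N := by rwa [hs.reg 0 (by omega)]
    have h3' : s.reg 3 ≤ N := by rwa [hs.reg 3 (by omega)]
    obtain ⟨t₁, s₁, hr₁, hv₁, ha₁, ht₁⟩ := i.compile_runs hc.1.1 le_rfl s h0' h3'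
    obtain ⟨t₂, s₂, hr₂, hv₂, ha₂, ht₂⟩ := j.compile_runs hc.1.2 (k := 21) (by omega) s₁ (N := N)
      (by rwa [ha₁.reg 0 (by omega)]) (by rwa [ha₁.reg 3 (by omega)])
    have ha₁₂ := ha₁.trans (ha₂.mono (by omega))
    obtain ⟨t₃, s₃, hr₃, hv₃, ha₃, ht₃⟩ := e.compile_runs hc.2 (k := 22) (by omega) s₂ (N := N)
      (by rwa [ha₁₂.reg 0 (by omega)]) (by rwa [ha₁₂.reg 3 (by omega)])
    have ha := ha₁₂.trans (ha₃.mono (by omega))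
    refine ⟨_, _, .seq hr₁ (.seq hr₂ (.seq hr₃ (.store _ _ _ _ _))), ⟨fun z hz => ?_, ?_⟩, ?_⟩
    · simp [exec, ha.reg z hz, hs.reg z hz]
    · simp only [RamExpr.eval, hv₃, ha₃.reg 21 (by omega), hv₂, ha₃.reg 20 (by omega),
        ha₂.reg 20 (by omega), hv₁, RamState.setArr, exec, ha.arr, hs.arr,
        e.eval_congr hc.2 (hs.trans ha₁₂), j.eval_congr hc.1.2 (hs.trans ha₁),
        i.eval_congr hc.1.1 hs]
    · simp [cost, RamExpr.cost]; omega
  | seq c d ihc ihd =>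
    simp only [wf, Bool.and_eq_true] at hc
    obtain ⟨t, s', hr, ha, ht⟩ := ihc hc.1 s₀ s hs h0 h3
    have hw := not_writes_bounds hc.1
    obtain ⟨u, s'', hr', ha', hu⟩ := ihd hc.2 (c.exec s₀) s' ha
      (by rwa [exec_reg_of_not_writes hw.1]) (by rwa [exec_reg_of_not_writes hw.2])
    exact ⟨_, _, .seq hr hr', ha', by simp [cost]; omega⟩
  | forLoop x y c ih =>
    have hw := hc
    simp only [wf, Bool.and_eq_true, Bool.or_eq_true, beq_iff_eq, decide_eq_true_eq,
      Bool.not_eq_true'] at hc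
    obtain ⟨⟨⟨⟨⟨hx, hx0⟩, hx3⟩, hy⟩, hwx⟩, hwc⟩ := hc
    have hw' := not_writes_bounds hwc
    have hyN : s₀.reg y ≤ N := by rcases hy with rfl | rfl <;> assumption
    let st : ℕ → RamState := fun n =>
      Nat.rec (s₀.setReg x 0) (fun i s' => (exec c s').setReg x (i + 1)) n
    have hreg : ∀ i z, z = 0 ∨ z = 3 → (st i).reg z = s₀.reg z := by
      intro i z hz
      have hzx : z ≠ x := by rintro rfl; simp_all
      have hzw : c.writes z = false := by rcases hz with rfl | rfl <;> simp [hw']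
      induction i with
      | zero => simp [st, hzx]
      | succ i ihi =>
        rw [← ihi]
        simp [st, hzx, exec_reg_of_not_writes hzw]
    have hregx : ∀ i, (st i).reg x = i := by rintro (_ | i) <;> simp [st]
    obtain ⟨t, s', hr, hI, ht⟩ := RamProg.runs_loop (x := x) (y := y) (n := s₀.reg y)
      (T := c.cost.eval N + 4)
      (body := .seq (compile c) (.assign x (.add (.reg x) (.const 1))))
      (fun i s' => (st i).AgreeBelow 20 s')
      (fun i s' h => ⟨by rw [h.reg x hx, hregx], by rw [h.reg y (by omega), hreg i y hy]⟩)
      (by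
        intro i hi s' h
        obtain ⟨t, s'', hr, ha, ht⟩ := ih hwc (st i) s' h (by rwa [hreg i 0 (by simp)])
          (by rwa [hreg i 3 (by simp)])
        refine ⟨_, _, .seq hr (.assign _ _ _), ?_, ?_⟩
        · have : s''.reg x = i := by
            rw [ha.reg x hx, exec_reg_of_not_writes hwx, hregx]
          simp only [RamExpr.eval, this]
          exact ha.setReg _ _
        · simp [RamExpr.cost, ht])
      (s.setReg x 0) (hs.setReg x 0)
    refine ⟨_, s', .seq (.assign _ _ _) hr, hI, ?_⟩
    have : s₀.reg y * (c.cost.eval N + 4 + 4) ≤ N * (c.cost.eval N + 8) :=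
      Nat.mul_le_mul hyN le_rfl
    simp [cost, RamExpr.cost]; omega

/-- The invariant rule for loops. -/
theorem exec_forLoop {x y : ℕ} {c : Cmd} (s : RamState) (Inv : ℕ → RamState → Prop)
    (h0 : Inv 0 (s.setReg x 0))
    (h : ∀ i < s.reg y, ∀ s', Inv i s' → Inv (i + 1) ((c.exec s').setReg x (i + 1))) :
    Inv (s.reg y) ((forLoop x y c).exec s) := by
  have : ∀ n ≤ s.reg y, Inv n (Nat.rec (s.setReg x 0)
      (fun i s' => (exec c s').setReg x (i + 1)) n) := by
    intro n hn
    induction n with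
    | zero => exact h0
    | succ n ih => exact h n hn _ (ih (by omega))
  exact this _ le_rfl

end Cmd

/-! ### Grouping the vertices into buckets -/

/-- An assignment `B` of the vertices in `S` to buckets, where bucket `b` has the label `b % L`, such
that each bucket has at most `cap` vertices and at most one edge to the buckets of any one label.
The first two fields exclude that this fails at a single edge or at two edges with a common end. -/
structure IsGrouping {V : Type*} (G : SimpleGraph V) (L cap : ℕ) (S : Set V) (B : V → ℕ) :
    Prop where
  adj_ne : ∀ u ∈ S, ∀ v ∈ S, G.Adj u v → B u % L ≠ B v % L
  common_ne : ∀ u ∈ S, ∀ v ∈ S, ∀ w, u ≠ v → G.Adj w u → G.Adj w v → B u % L ≠ B v % L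
  unique : ∀ u ∈ S, ∀ v ∈ S, ∀ u' ∈ S, ∀ v' ∈ S, G.Adj u v → G.Adj u' v' → B u = B u' →
    B v % L = B v' % L → u = u'
  load : ∀ b, {u ∈ S | B u = b}.ncard ≤ cap

/-- Bucket `b` can take the vertex `x`. -/
structure Fits {V : Type*} (G : SimpleGraph V) (L cap : ℕ) (S : Set V) (B : V → ℕ) (x : V) (b : ℕ) :
    Prop where
  near : ∀ w ∈ S, (G.Adj x w ∨ ∃ z, G.Adj z w ∧ G.Adj z x) → B w % L ≠ b % L
  edge : ∀ w ∈ S, ∀ u ∈ S, ∀ v ∈ S, G.Adj x w → G.Adj u v →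
    (B v % L = B w % L → B u ≠ b) ∧ (B u = B w → B v % L ≠ b % L)
  load : {u ∈ S | B u = b}.ncard < cap

section Grouping

variable {V : Type*} {G : SimpleGraph V} {L cap : ℕ} {S : Set V} {B : V → ℕ}

theorem IsGrouping.insert [Finite V] {x : V} {b : ℕ} (h : IsGrouping G L cap S B) (hx : x ∉ S)
    (hb : Fits G L cap S B x b) {B' : V → ℕ} (hBx : B' x = b) (hB : ∀ u ∈ S, B' u = B u) :
    IsGrouping G L cap (insert x S) B' := by
  have hne : ∀ u ∈ S, u ≠ x := fun u hu e => hx (e ▸ hu)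
  refine ⟨?_, ?_, ?_, ?_⟩
  · rintro u (rfl | hu) v (rfl | hv) huv
    · exact (G.irrefl huv).elim
    · rw [hBx, hB v hv]; exact (hb.near v hv (.inl huv)).symm
    · rw [hBx, hB u hu]; exact hb.near u hu (.inl huv.symm)
    · rw [hB u hu, hB v hv]; exact h.adj_ne u hu v hv huv
  · rintro u (rfl | hu) v (rfl | hv) w huv hwu hwv
    · exact (huv rfl).elim
    · rw [hBx, hB v hv]; exact (hb.near v hv (.inr ⟨w, hwv, hwu⟩)).symm
    · rw [hBx, hB u hu]; exact hb.near u hu (.inr ⟨w, hwu, hwv⟩)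
    · rw [hB u hu, hB v hv]; exact h.common_ne u hu v hv w huv hwu hwv
  · -- At least one of the two edges ends in `x`; the cases are the positions of `x`.
    rintro u (rfl | hu) v (rfl | hv) u' (rfl | hu') v' (rfl | hv') huv hu'v' hBu hBv
    all_goals try rfl
    all_goals try exact (G.irrefl huv).elim
    all_goals try exact (G.irrefl hu'v').elim
    · rw [hBx, hB v hv] at hBv
      exact (hb.near v hv (.inl huv) hBv).elim
    · rw [hBx, hB u' hu'] at hBu
      rw [hB v hv, hB v' hv'] at hBv
      exact ((hb.edge v hv u' hu' v' hv' huv hu'v').1 hBv.symm hBu.symm).elim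
    · rw [hBx, hB v' hv'] at hBv
      exact (hb.near v' hv' (.inl hu'v') hBv.symm).elim
    · rw [hB u hu, hB u' hu'] at hBu
      by_contra hc
      exact h.common_ne u hu u' hu' _ hc huv.symm hu'v'.symm (by rw [hBu])
    · rw [hB u hu, hB u' hu'] at hBu
      rw [hBx, hB v' hv'] at hBv
      exact ((hb.edge u hu u' hu' v' hv' huv.symm hu'v').2 hBu.symm hBv.symm).elim
    · rw [hBx, hB u hu] at hBu
      rw [hB v hv, hB v' hv'] at hBv
      exact ((hb.edge v' hv' u hu v hv hu'v' huv).1 hBv hBu).elim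
    · rw [hB u hu, hB u' hu'] at hBu
      rw [hBx, hB v hv] at hBv
      exact ((hb.edge u' hu' u hu v hv hu'v'.symm huv).2 hBu hBv).elim
    · rw [hB u hu, hB u' hu'] at hBu
      rw [hB v hv, hB v' hv'] at hBv
      exact h.unique u hu v hv u' hu' v' hv' huv hu'v' hBu hBv
  · intro c
    by_cases hc : c = b
    · subst hc
      have : {u ∈ Insert.insert x S | B' u = c} ⊆ Insert.insert x {u ∈ S | B u = c} := by
        rintro u ⟨rfl | hu, hu'⟩
        · exact .inl rfl
        · exact .inr ⟨hu, by rw [← hB u hu, hu']⟩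
      have h1 := Set.ncard_le_ncard this (Set.toFinite _)
      have h2 := Set.ncard_insert_le x {u ∈ S | B u = c}
      have h3 := hb.load
      omega
    · refine (Set.ncard_le_ncard (t := {u ∈ S | B u = c}) ?_ (Set.toFinite _)).trans (h.load c)
      rintro u ⟨rfl | hu, hu'⟩
      · exact (hc (hu'.symm.trans hBx)).elim
      · exact ⟨hu, by rw [← hB u hu, hu']⟩

/-- If there are more buckets than the constraints of `Fits` can exclude, then some bucket fits.
The factor `k / L + 1` bounds the number of buckets of any one label, and `|V| / cap` the number of
full buckets. -/
theorem IsGrouping.exists_fits [Fintype V] [DecidableRel G.Adj] (h : IsGrouping G L cap S B)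
    {D k : ℕ} (hBk : ∀ v ∈ S, B v < k) (hD : ∀ v, G.degree v ≤ D) (hL : 0 < L) (hcap : 0 < cap)
    (hk : (D + D * D + 2 * (D * D * cap)) * (k / L + 1) + Fintype.card V / cap < k) (x : V) :
    ∃ b < k, Fits G L cap S B x b := by
  classical
  let N : V → Finset V := fun v => G.neighborFinset v
  have hN : ∀ v, (N v).card ≤ D := fun v => by simpa [N] using hD v
  have hbU : ∀ (s : Finset V) (m : ℕ), s.card ≤ m → (s.biUnion N).card ≤ m * D := fun s m hs =>
    (Finset.card_biUnion_le_card_mul _ _ _ fun v _ => hN v).trans (Nat.mul_le_mul_right _ hs)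
  let load : ℕ → Finset V := fun b => {u | u ∈ S ∧ B u = b}
  have hload : ∀ b, (load b).card ≤ cap := fun b => by
    have := h.load b
    rwa [Set.ncard_eq_toFinset_card', Set.toFinset_ofPred] at this
  let lab : ℕ → Finset ℕ := fun l => {b ∈ Finset.range k | b % L = l % L}
  have hlab : ∀ l, (lab l).card ≤ k / L + 1 := fun l => by
    have := Nat.count_modEq_card k hL l
    rw [Nat.count_eq_card_filter_range] at this
    change (lab l).card = _ at this
    rw [this]
    split_ifs <;> omega
  -- The labels that the constraints forbid.
  let W : Finset V := N x ∪ (N x).biUnion N ∪ (((N x).biUnion fun w => load (B w)).biUnion N)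
  have hW : W.card ≤ D + D * D + D * cap * D := by
    refine (Finset.card_union_le _ _).trans (Nat.add_le_add ((Finset.card_union_le _ _).trans
      (Nat.add_le_add (hN x) (hbU _ _ (hN x)))) (hbU _ _ ?_))
    exact (Finset.card_biUnion_le_card_mul _ _ _ fun w _ => hload (B w)).trans
      (Nat.mul_le_mul_right _ (hN x))
  let X₁ : Finset ℕ := W.biUnion fun w => lab (B w)
  have hX₁ : X₁.card ≤ (D + D * D + D * cap * D) * (k / L + 1) :=
    (Finset.card_biUnion_le_card_mul _ _ _ fun w _ => hlab _).trans (Nat.mul_le_mul_right _ hW)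
  -- The buckets that already have an edge to the label of a neighbour of `x`.
  let X₂ : Finset ℕ := ((((N x).biUnion fun w => lab (B w)).biUnion load).biUnion N).image B
  have hX₂ : X₂.card ≤ D * (k / L + 1) * cap * D := by
    refine Finset.card_image_le.trans (hbU _ _ ?_)
    refine (Finset.card_biUnion_le_card_mul _ _ _ fun w _ => hload w).trans
      (Nat.mul_le_mul_right _ ?_)
    exact (Finset.card_biUnion_le_card_mul _ _ _ fun w _ => hlab _).trans
      (Nat.mul_le_mul_right _ (hN x))
  let X₃ : Finset ℕ := {b ∈ Finset.range k | cap ≤ (load b).card}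
  have hX₃ : X₃.card ≤ Fintype.card V / cap := by
    rw [Nat.le_div_iff_mul_le hcap]
    calc X₃.card * cap ≤ ∑ b ∈ X₃, (load b).card := by
          rw [← smul_eq_mul]
          exact Finset.card_nsmul_le_sum _ _ _ fun b hb => (Finset.mem_filter.1 hb).2
      _ = (X₃.biUnion load).card := by
          refine (Finset.card_biUnion fun b _ c _ hbc => ?_).symm
          rw [Function.onFun, Finset.disjoint_left]
          intro u hu hu'
          exact hbc ((Finset.mem_filter.1 hu).2.2.symm.trans (Finset.mem_filter.1 hu').2.2)
      _ ≤ Fintype.card V := Finset.card_le_univ _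
  have hcard : (X₁ ∪ X₂ ∪ X₃).card < (Finset.range k).card := by
    have h₁ := Finset.card_union_le X₁ X₂
    have h₂ := Finset.card_union_le (X₁ ∪ X₂) X₃
    have h₃ : (D + D * D + 2 * (D * D * cap)) * (k / L + 1) =
      (D + D * D + D * cap * D) * (k / L + 1) + D * (k / L + 1) * cap * D := by ring
    rw [Finset.card_range]
    omega
  obtain ⟨b, hbk, hb⟩ := Finset.exists_mem_notMem_of_card_lt_card hcard
  simp only [Finset.mem_union, not_or] at hb
  obtain ⟨⟨hb₁, hb₂⟩, hb₃⟩ := hb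
  have hnear : ∀ w ∈ W, B w % L ≠ b % L := fun w hw e =>
    hb₁ (Finset.mem_biUnion.2 ⟨w, hw, by simpa [lab, e] using hbk⟩)
  have hNN : ∀ {v w}, w ∈ N v ↔ G.Adj v w := fun {v w} => G.mem_neighborFinset v w
  refine ⟨b, Finset.mem_range.1 hbk, ⟨fun w _ hw => hnear w ?_, fun w hw u hu v hv hxw huv =>
    ⟨fun hvw hub => hb₂ ?_, fun huw => hnear v ?_⟩, ?_⟩⟩
  · rcases hw with hw | ⟨z, hzw, hzx⟩
    · exact Finset.mem_union_left _ (Finset.mem_union_left _ (hNN.2 hw))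
    · exact Finset.mem_union_left _ (Finset.mem_union_right _
        (Finset.mem_biUnion.2 ⟨z, hNN.2 hzx.symm, hNN.2 hzw⟩))
  · have hBv : B v ∈ lab (B w) := Finset.mem_filter.2 ⟨Finset.mem_range.2 (hBk v hv), hvw⟩
    have hmem : v ∈ ((N x).biUnion fun w => lab (B w)).biUnion load :=
      Finset.mem_biUnion.2 ⟨B v, Finset.mem_biUnion.2 ⟨w, hNN.2 hxw, hBv⟩, by simp [load, hv]⟩
    exact Finset.mem_image.2 ⟨u, Finset.mem_biUnion.2 ⟨v, hmem, hNN.2 huv.symm⟩, hub⟩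
  · exact Finset.mem_union_right _ (Finset.mem_biUnion.2 ⟨u, Finset.mem_biUnion.2
      ⟨w, hNN.2 hxw, by simp [load, hu, huw]⟩, hNN.2 huv⟩)
  · have : (load b).card < cap := by
      by_contra hc
      exact hb₃ (Finset.mem_filter.2 ⟨hbk, by omega⟩)
    rwa [Set.ncard_eq_toFinset_card', Set.toFinset_ofPred]

end Grouping

/-! ### The instance that belongs to a grouping -/

/-- Digit `j` of the ternary expansion of `a`. -/
def ternaryDigit (a j : ℕ) : ℕ := a / 3 ^ j % 3

theorem ternaryDigit_lt (a j : ℕ) : ternaryDigit a j < 3 := Nat.mod_lt _ (by norm_num)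

theorem exists_ternaryDigit_eq (L q : ℕ) (f : ℕ → ℕ) (hf : ∀ j, f j < 3) :
    ∃ a, a / 3 ^ L = q ∧ ∀ j < L, ternaryDigit a j = f j := by
  induction L generalizing f with
  | zero => exact ⟨q, by simp, by simp⟩
  | succ L ih =>
    obtain ⟨a, ha, hd⟩ := ih (fun j => f (j + 1)) fun j => hf _
    have h0 := hf 0
    have hdiv : (3 * a + f 0) / 3 = a := by omega
    refine ⟨3 * a + f 0, ?_, ?_⟩
    · rw [pow_succ', ← Nat.div_div_eq_div_mul, hdiv, ha]
    · rintro (_ | j) hj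
      · simp only [ternaryDigit, pow_zero, Nat.div_one]; omega
      · rw [← hd j (by omega), ternaryDigit, ternaryDigit, pow_succ', ← Nat.div_div_eq_div_mul, hdiv]

theorem lt_nine_pow_iff {L a : ℕ} : a < 9 ^ L ↔ a / 3 ^ L < 3 ^ L := by
  rw [Nat.div_lt_iff_lt_mul (by positivity), ← mul_pow]; norm_num

/-- The list homomorphism instance of a grouping `B` into `k` buckets. A target vertex `a < 9 ^ L`
encodes a label, `a / 3 ^ L`, and a colour for each label `j < L`, the ternary digit `j` of `a`: if
bucket `i` is mapped to `a`, the digit `j` is the colour of the vertex of bucket `i` that has a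
neighbour in a bucket with label `j`. -/
def groupingInstance {n : ℕ} (G : SimpleGraph (Fin n)) (L cap k : ℕ) (B : Fin n → ℕ)
    (h : IsGrouping G L cap Set.univ B) : ListHomInstance where
  srcCard := k
  tgtCard := 9 ^ L
  src :=
    { Adj := fun i j => ∃ u v, G.Adj u v ∧ B u = i ∧ B v = j
      symm := ⟨fun _ _ ⟨u, v, huv, hu, hv⟩ => ⟨v, u, huv.symm, hv, hu⟩⟩
      loopless := ⟨fun _ ⟨u, v, huv, hu, hv⟩ =>
        h.adj_ne u trivial v trivial huv (by rw [hu, hv])⟩ }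
  tgt :=
    { Adj := fun a b => (a : ℕ) / 3 ^ L < L ∧ (b : ℕ) / 3 ^ L < L ∧
        ternaryDigit a (b / 3 ^ L) ≠ ternaryDigit b (a / 3 ^ L)
      symm := ⟨fun _ _ ⟨ha, hb, hab⟩ => ⟨hb, ha, hab.symm⟩⟩
      loopless := ⟨fun _ ⟨_, _, hab⟩ => hab rfl⟩ }
  lists := fun i => {a | (a : ℕ) / 3 ^ L = i % L ∧ ∀ u v w, B u = i → G.Adj u v → G.Adj u w →
    ternaryDigit a (B v % L) = ternaryDigit a (B w % L)}

theorem colorable_three_iff_satisfiable {n : ℕ} {G : SimpleGraph (Fin n)} {L cap k : ℕ}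
    {B : Fin n → ℕ} (h : IsGrouping G L cap Set.univ B) (hL : 0 < L) (hB : ∀ v, B v < k) :
    G.Colorable 3 ↔ (groupingInstance G L cap k B h).Satisfiable := by
  classical
  constructor
  · rintro ⟨χ⟩
    -- The colour of the unique vertex of bucket `i` with a neighbour of label `l`.
    have hf : ∀ i l, ∃ c < 3, ∀ u v, G.Adj u v → B u = i → B v % L = l → (χ u : ℕ) = c := by
      intro i l
      by_cases hex : ∃ u v, G.Adj u v ∧ B u = i ∧ B v % L = l
      · obtain ⟨u, v, huv, hu, hv⟩ := hex
        refine ⟨χ u, (χ u).2, fun u' v' huv' hu' hv' => ?_⟩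
        rw [h.unique u' trivial v' trivial u trivial v trivial huv' huv (hu'.trans hu.symm)
          (hv'.trans hv.symm)]
      · exact ⟨0, by norm_num, fun u v huv hu hv => (hex ⟨u, v, huv, hu, hv⟩).elim⟩
    choose f hf3 hf using hf
    have ha : ∀ i : Fin k, ∃ a : Fin (9 ^ L), (a : ℕ) / 3 ^ L = i % L ∧
        ∀ j < L, ternaryDigit a j = f i j := fun i => by
      obtain ⟨a, ha, hd⟩ := exists_ternaryDigit_eq L (i % L) (f i) (hf3 i)
      have : a < 9 ^ L := lt_nine_pow_iff.2
        (ha ▸ (Nat.mod_lt _ hL).trans (Nat.lt_pow_self (by norm_num)))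
      exact ⟨⟨a, this⟩, ha, hd⟩
    choose φ hφ hd using ha
    have hdig : ∀ (i : Fin k) u v, B u = i → G.Adj u v →
        ternaryDigit (φ i) (B v % L) = χ u := fun i u v hu huv => by
      rw [hd i _ (Nat.mod_lt _ hL), hf i _ u v huv hu rfl]
    refine ⟨⟨φ, ?_⟩, fun i => ⟨hφ i, fun u v w hu huv huw => ?_⟩⟩
    · rintro i j ⟨u, v, huv, hu, hv⟩
      refine ⟨(hφ i).trans_lt (Nat.mod_lt _ hL), (hφ j).trans_lt (Nat.mod_lt _ hL), ?_⟩
      rw [hφ i, hφ j, ← hu, ← hv, hdig i u v hu huv, hdig j v u hv huv.symm]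
      exact fun e => χ.valid huv (Fin.ext e)
    · exact (hdig i u v hu huv).trans (hdig i u w hu huw).symm
  · rintro ⟨φ, hφ⟩
    let b : Fin n → Fin k := fun v => ⟨B v, hB v⟩
    have hc : ∀ u, ∃ c : Fin 3, ∀ v, G.Adj u v →
        ternaryDigit (φ (b u)).val (B v % L) = c := by
      intro u
      by_cases hex : ∃ w, G.Adj u w
      · obtain ⟨w, huw⟩ := hex
        exact ⟨⟨_, ternaryDigit_lt _ _⟩, fun v huv => (hφ (b u)).2 u v w rfl huv huw⟩
      · exact ⟨0, fun v huv => (hex ⟨v, huv⟩).elim⟩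
    choose χ hχ using hc
    refine ⟨⟨χ, fun {u v} huv e => ?_⟩⟩
    obtain ⟨-, -, hne⟩ := φ.map_rel (show (groupingInstance G L cap k B h).src.Adj (b u) (b v) from
      ⟨u, v, huv, rfl, rfl⟩)
    rw [(hφ (b u)).1, (hφ (b v)).1] at hne
    exact hne (by rw [hχ u v huv, hχ v u huv.symm, e])

/-! ### The choice of the parameters -/

/-- The number of labels, for maximum degree `D`. With `24 = 4 * 6`, the labels that
`IsGrouping.exists_fits` excludes, at most `6 * (D + 1) ^ 2 * r`, make up a quarter of all. -/
def labelCount (D r : ℕ) : ℕ := 24 * ((D + 1) * (D + 1)) * r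

theorem two_mul_labelCount_le {D n r : ℕ} (hr : 1 ≤ r) (h : 64 * ((D + 1) * r) ^ 2 ≤ n) :
    2 * labelCount D r ≤ n := by
  have : (D + 1) * (D + 1) * r ≤ ((D + 1) * r) ^ 2 := by
    rw [mul_pow, sq, sq, ← mul_assoc]
    exact Nat.le_mul_of_pos_right _ hr
  simp only [labelCount]
  nlinarith

/-- There are more buckets than `IsGrouping.exists_fits` requires. -/
theorem bucket_count_lt {D n r : ℕ} (hr : 1 ≤ r) (h : 64 * ((D + 1) * r) ^ 2 ≤ n) :
    (D + D * D + 2 * (D * D * (r + r))) * (n / r / labelCount D r + 1) + n / (r + r) < n / r := by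
  have hk : 64 * ((D + 1) * (D + 1) * r) ≤ n / r := by
    rw [Nat.le_div_iff_mul_le hr]
    linarith [show 64 * ((D + 1) * r) ^ 2 = 64 * ((D + 1) * (D + 1) * r) * r by ring]
  have hpos : 0 < (D + 1) * (D + 1) * r := by positivity
  have hhalf : n / (r + r) = n / r / 2 := by rw [Nat.div_div_eq_div_mul, mul_two]
  have hle : D + D * D + 2 * (D * D * (r + r)) ≤ 6 * ((D + 1) * (D + 1) * r) := by
    nlinarith [Nat.mul_le_mul_left (D + D * D) hr]
  have hdiv := Nat.mul_div_le (n / r) (labelCount D r)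
  have hmul := Nat.mul_le_mul_right (n / r / labelCount D r + 1) hle
  rw [hhalf]
  simp only [labelCount] at *
  generalize n / r / (24 * ((D + 1) * (D + 1)) * r) = q at *
  generalize n / r = k at *
  have h₁ : 4 * (6 * ((D + 1) * (D + 1) * r) * (q + 1)) =
    24 * ((D + 1) * (D + 1)) * r * q + 24 * ((D + 1) * (D + 1) * r) := by ring
  omega

/-! ### Bounded quantifiers -/

namespace SumExpr

/-- The truth of an expression as a condition. -/
def Holds (e : SumExpr) (s : RamState) : Prop := e.eval s ≠ 0

/-- Addition. -/
def add (e f : SumExpr) : SumExpr := .bin .add e f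

/-- Truncated subtraction. -/
def sub (e f : SumExpr) : SumExpr := .bin .sub e f

/-- `e < f`. -/
def lt (e f : SumExpr) : SumExpr := .bin .lt e f

/-- `e ≤ f`. -/
def le (e f : SumExpr) : SumExpr := .bin .lt e (.bin .add f (.const 1))

/-- `e = f`. -/
def eq (e f : SumExpr) : SumExpr := .bin .eq e f

/-- Negation. -/
def not (e : SumExpr) : SumExpr := .ite e (.const 0) (.const 1)

/-- Conjunction. -/
def and (e f : SumExpr) : SumExpr := .ite e f (.const 0)

/-- Disjunction. -/
def or (e f : SumExpr) : SumExpr := .ite e (.const 1) f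

/-- Implication. -/
def imp (e f : SumExpr) : SumExpr := .ite e f (.const 1)

/-- `∃ x < reg y, e`. -/
def ex (x y : ℕ) (e : SumExpr) : SumExpr := .sum x y e

/-- `∀ x < reg y, e`. -/
def all (x y : ℕ) (e : SumExpr) : SumExpr := .not (.sum x y (.not e))

/-- The number of all `x < reg y` with `e`. -/
def count (x y : ℕ) (e : SumExpr) : SumExpr := .sum x y (.ite e (.const 1) (.const 0))

/-- The product `(reg x + 1) * f`, as the sum of `f` over all `z ≤ reg x` below the bound `reg y`. -/
def succMul (z y x : ℕ) (f : SumExpr) : SumExpr :=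
  .sum z y (.ite (lt (.reg x) (.reg z)) (.const 0) f)

/-- The multiple `k • e`. -/
def smul : ℕ → SumExpr → SumExpr
  | 0, _ => .const 0
  | k + 1, e => add (smul k e) e

/-- The least `x' < reg y` with `e`, as the number of all `x < reg y` such that `e` fails for all
`x' ≤ x`. -/
def first (x x' y : ℕ) (e : SumExpr) : SumExpr :=
  count x y (all x' y (imp (le (.reg x') (.reg x)) (.not e)))

section

variable (s : RamState) (e f c : SumExpr) (x x' y z a k : ℕ)

@[simp] theorem eval_const : (const k).eval s = k := rfl
@[simp] theorem eval_reg : (reg x).eval s = s.reg x := rfl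
@[simp] theorem eval_get : (get a e f).eval s = s.arr a (e.eval s) (f.eval s) := rfl
@[simp] theorem eval_add : (add e f).eval s = e.eval s + f.eval s := rfl
@[simp] theorem eval_sub : (sub e f).eval s = e.eval s - f.eval s := rfl
@[simp] theorem eval_sum :
    (sum x y e).eval s = ∑ i ∈ Finset.range (s.reg y), e.eval (s.setReg x i) := rfl

open Classical in
@[simp] theorem eval_ite : (ite c e f).eval s = if c.Holds s then e.eval s else f.eval s := by
  by_cases h : c.eval s = 0 <;> simp [eval, Holds, h]

open Classical in
@[simp] theorem eval_count : (count x y e).eval s =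
    ((Finset.range (s.reg y)).filter fun i => e.Holds (s.setReg x i)).card := by
  simp [count]

@[simp] theorem eval_smul : (smul k e).eval s = k * e.eval s := by
  induction k with
  | zero => simp [smul]
  | succ k ih => simp [smul, ih, Nat.succ_mul]

@[simp] theorem holds_get : (get a e f).Holds s ↔ s.arr a (e.eval s) (f.eval s) ≠ 0 := Iff.rfl
@[simp] theorem holds_lt : (lt e f).Holds s ↔ e.eval s < f.eval s := by
  simp [Holds, lt, eval, BinOp.eval]
@[simp] theorem holds_le : (le e f).Holds s ↔ e.eval s ≤ f.eval s := by
  simp [Holds, le, eval, BinOp.eval]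
@[simp] theorem holds_eq : (eq e f).Holds s ↔ e.eval s = f.eval s := by
  simp [Holds, eq, eval, BinOp.eval]
@[simp] theorem holds_not : (not e).Holds s ↔ ¬ e.Holds s := by
  by_cases h : e.eval s = 0 <;> simp [Holds, not, eval, h]
@[simp] theorem holds_and : (and e f).Holds s ↔ e.Holds s ∧ f.Holds s := by
  simp only [Holds, and, eval]; split_ifs <;> simp_all
@[simp] theorem holds_or : (or e f).Holds s ↔ e.Holds s ∨ f.Holds s := by
  simp only [Holds, or, eval]; split_ifs <;> simp_all
@[simp] theorem holds_imp : (imp e f).Holds s ↔ (e.Holds s → f.Holds s) := by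
  simp only [Holds, imp, eval]; split_ifs <;> simp_all
@[simp] theorem holds_ex : (ex x y e).Holds s ↔ ∃ i < s.reg y, e.Holds (s.setReg x i) := by
  simp [Holds, ex, Finset.sum_eq_zero_iff]
@[simp] theorem holds_all : (all x y e).Holds s ↔ ∀ i < s.reg y, e.Holds (s.setReg x i) := by
  simp only [all, holds_not]
  have := holds_ex s (not e) x y
  simp only [ex, holds_not] at this
  rw [this]
  push Not
  rfl

end

theorem eval_succMul {s : RamState} {z y x : ℕ} {f : SumExpr} {v : ℕ} (hzx : x ≠ z)
    (hf : ∀ i, f.eval (s.setReg z i) = v) (hy : s.reg x < s.reg y) :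
    (succMul z y x f).eval s = (s.reg x + 1) * v := by
  have : (Finset.range (s.reg y)).filter (fun i => ¬ s.reg x < i) =
      Finset.range (s.reg x + 1) := by
    ext i
    simp only [Finset.mem_filter, Finset.mem_range]
    omega
  simp only [succMul, eval_sum, eval_ite, holds_lt, eval_reg, RamState.reg_setReg, hzx, if_false,
    if_true, eval_const, hf]
  rw [Finset.sum_ite, this]
  simp

open Classical in
/-- Counting the indices up to which a property fails finds its first instance. -/
theorem _root_.Finset.card_filter_range_forall_le_not {n : ℕ} {p : ℕ → Prop}
    (h : ∃ i < n, p i) :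
    p ((Finset.range n).filter fun i => ∀ j < n, j ≤ i → ¬ p j).card := by
  obtain ⟨i, hi, hpi⟩ := h
  have hex : ∃ i, p i := ⟨i, hpi⟩
  have hlt : Nat.find hex < n := (Nat.find_le hpi).trans_lt hi
  have : (Finset.range n).filter (fun i => ∀ j < n, j ≤ i → ¬ p j) =
      Finset.range (Nat.find hex) := by
    ext m
    simp only [Finset.mem_filter, Finset.mem_range]
    constructor
    · rintro ⟨hm, hj⟩
      by_contra hc
      exact hj _ hlt (by omega) (Nat.find_spec hex)
    · exact fun hm => ⟨hm.trans hlt, fun j _ hj => Nat.find_min hex (hj.trans_lt hm)⟩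
  rw [this, Finset.card_range]
  exact Nat.find_spec hex

theorem eval_first {s : RamState} {x x' y : ℕ} {e : SumExpr} {p : ℕ → Prop} (hxy : y ≠ x)
    (hx : x ≠ x') (hp : ∀ i, ∀ j < s.reg y, e.Holds ((s.setReg x i).setReg x' j) ↔ p j)
    (h : ∃ j < s.reg y, p j) : p ((first x x' y e).eval s) := by
  classical
  convert Finset.card_filter_range_forall_le_not h using 1
  simp only [first, eval_count, holds_all, holds_imp, holds_le, holds_not, eval_reg,
    RamState.reg_setReg, hxy, hx, if_false, if_true]
  congr 1
  refine Finset.filter_congr fun i _ => ⟨fun h j hj hji => ?_, fun h j hj hji => ?_⟩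
  · rw [← hp i j hj]; exact h j hj hji
  · rw [hp i j hj]; exact h j hj hji

end SumExpr

theorem Nat.card_filter_succ_mul_le {n a q : ℕ} (hq : 0 < q) (h : a / q ≤ n) :
    ((Finset.range n).filter fun i => (i + 1) * q ≤ a).card = a / q := by
  have : (Finset.range n).filter (fun i => (i + 1) * q ≤ a) = Finset.range (a / q) := by
    ext i
    simp only [Finset.mem_filter, Finset.mem_range, ← Nat.le_div_iff_mul_le hq]
    omega
  rw [this, Finset.card_range]

/-! ### Loops that fill arrays -/

/-- Two memories agree except in array `a` and in the registers from `10` on, which serve as loop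
counters. -/
structure RamState.SameBut (a : ℕ) (s s' : RamState) : Prop where
  reg : ∀ z < 10, s'.reg z = s.reg z
  arr : ∀ b, b ≠ a → s'.arr b = s.arr b

namespace Cmd

open RamState SumExpr

/-- A loop that fills an array row by row, where `Q i` is an invariant of the array. -/
theorem exec_forLoop_store {x y a : ℕ} {i j e : SumExpr} (s : RamState)
    (Q : ℕ → (ℕ → ℕ → ℕ) → Prop) (hx : 10 ≤ x) (h0 : Q 0 (s.arr a))
    (h : ∀ m < s.reg y, ∀ s', s.SameBut a s' → s'.reg x = m → Q m (s'.arr a) →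
      Q (m + 1) fun k l => if k = i.eval s' ∧ l = j.eval s' then e.eval s' else s'.arr a k l) :
    s.SameBut a ((forLoop x y (store a i j e)).exec s) ∧
      Q (s.reg y) (((forLoop x y (store a i j e)).exec s).arr a) := by
  have := exec_forLoop (x := x) (y := y) (c := store a i j e) s
    (fun m s' => s.SameBut a s' ∧ s'.reg x = m ∧ Q m (s'.arr a))
    ⟨⟨fun z hz => by simp [(hz.trans_le hx).ne], fun _ _ => rfl⟩, by simp, h0⟩
    (by
      rintro m hm s' ⟨hs, hxm, hQ⟩
      refine ⟨⟨fun z hz => ?_, fun b hb => ?_⟩, by simp, ?_⟩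
      · simp [exec, (hz.trans_le hx).ne, hs.reg z hz]
      · funext k l
        simp [exec, hb, hs.arr b hb]
      · simpa [exec, RamState.setArr, RamState.setReg] using h m hm s' hs hxm hQ)
  exact ⟨this.1, this.2.2⟩

/-- The command that fills a table: cell `(reg x, reg x')` of array `a` becomes `e`. -/
def table (a x y x' y' : ℕ) (e : SumExpr) : Cmd :=
  .forLoop x y (.forLoop x' y' (.store a (.reg x) (.reg x') e))

theorem exec_table {a x y x' y' : ℕ} {e : SumExpr} (s : RamState) (hx : 10 ≤ x) (hx' : 10 ≤ x')
    (hxx' : x ≠ x') (hy' : y' < 10) (p : ℕ → ℕ → ℕ → Prop)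
    (hf : ∀ i < s.reg y, ∀ j < s.reg y', ∀ s', s.SameBut a s' → s'.reg x = i → s'.reg x' = j →
      p i j (e.eval s')) :
    s.SameBut a ((table a x y x' y' e).exec s) ∧
      ∀ i < s.reg y, ∀ j < s.reg y', p i j (((table a x y x' y' e).exec s).arr a i j) := by
  have := exec_forLoop (x := x) (y := y) (c := .forLoop x' y' (.store a (.reg x) (.reg x') e)) s
    (fun m s' => s.SameBut a s' ∧ s'.reg x = m ∧
      ∀ i < m, ∀ j < s.reg y', p i j (s'.arr a i j))
    ⟨⟨fun z hz => by simp [(hz.trans_le hx).ne], fun _ _ => rfl⟩, by simp, by simp⟩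
    (by
      rintro m hm s₁ ⟨hs₁, hxm, hQ⟩
      have := exec_forLoop (x := x') (y := y') (c := .store a (.reg x) (.reg x') e) s₁
        (fun l s' => s.SameBut a s' ∧ s'.reg x = m ∧ s'.reg x' = l ∧
          (∀ i < m, ∀ j < s.reg y', p i j (s'.arr a i j)) ∧ ∀ j < l, p m j (s'.arr a m j))
        ⟨⟨fun z hz => by simp [(hz.trans_le hx').ne, hs₁.reg z hz], hs₁.arr⟩,
          by simp [hxx', hxm], by simp, hQ, by simp⟩
        (by
          rintro l hl s₂ ⟨hs₂, hxm₂, hxl₂, hQ₂, hR₂⟩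
          rw [hs₁.reg y' hy'] at hl
          have he := hf m hm l hl s₂ hs₂ hxm₂ hxl₂
          refine ⟨⟨fun z hz => ?_, fun b hb => ?_⟩, by simp [exec, hxx', hxm₂], by simp, ?_, ?_⟩
          · simp [exec, (hz.trans_le hx').ne, hs₂.reg z hz]
          · funext k l
            simp [exec, hb, hs₂.arr b hb]
          · intro i hi j hj
            simpa [exec, hxm₂, hi.ne] using hQ₂ i hi j hj
          · intro j hj
            by_cases hjl : j = l
            · simpa [exec, hxm₂, hxl₂, hjl] using he
            · simpa [exec, hxl₂, hjl] using hR₂ j (by omega))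
      obtain ⟨h₁, h₂, h₃, h₄, h₅⟩ := this
      refine ⟨⟨fun z hz => ?_, h₁.arr⟩, by simp, fun i hi j hj => ?_⟩
      · simp [(hz.trans_le hx).ne, h₁.reg z hz]
      · rw [hs₁.reg y' hy'] at h₅
        rcases Nat.lt_succ_iff_lt_or_eq.1 hi with hi | rfl
        · exact h₄ i hi j hj
        · exact h₅ j hj)
  exact ⟨this.1, this.2.2⟩

end Cmd

/-! ### The program -/

/-!
Registers: `0` the number `n` of vertices, `1` the parameter `r`, `2` and `3` the numbers `k` and
`9 ^ L` of vertices of the source and the target, `4` the maximum degree, `5` the number `L` of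
labels. Arrays: `0` the input graph, `1` the source, `2` the target, `3` the lists, `4` the labels of
the buckets, `5` the buckets of the vertices, `6` the powers of `3`, `7` the quotients
`a / 3 ^ j`.
-/

open SumExpr RamState

/-- Registers `x` and `y` hold adjacent vertices of the input graph. -/
def adjE (x y : ℕ) : SumExpr := .get 0 (.reg x) (.reg y)

/-- The bucket of the vertex in register `x`. -/
def bucketE (x : ℕ) : SumExpr := .get 5 (.reg x) (.const 0)

/-- The label of the bucket with number `e`. -/
def labelE (e : SumExpr) : SumExpr := .get 4 e (.const 0)

/-- The label that a target vertex encodes. -/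
def targetLabelE (x : ℕ) : SumExpr := .get 7 (.reg x) (.reg 5)

/-- The ternary digit `e` of the target vertex in register `x`. -/
def digitE (x : ℕ) (e : SumExpr) : SumExpr :=
  sub (.get 7 (.reg x) e) (smul 3 (.get 7 (.reg x) (add e (.const 1))))

/-- The maximum degree, as the number of all `i` below the degree of some vertex. -/
def maxDegreeE : SumExpr :=
  count 10 0 (ex 11 0 (lt (.reg 10) (.sum 12 0 (adjE 11 12))))

/-- The number of labels, `labelCount`. -/
def labelCountE : SumExpr := smul 24 (succMul 12 0 4 (succMul 11 0 4 (.reg 1)))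

/-- The number of buckets, `n / r`. -/
def bucketCountE : SumExpr :=
  count 10 0 (le (.sum 11 0 (.ite (lt (.reg 11) (.reg 1)) (add (.reg 10) (.const 1)) (.const 0)))
    (.reg 0))

/-- The condition `Fits` for the vertex in register `10`, the bucket in register `11` and the set of
all smaller vertices. -/
def fitsE : SumExpr :=
  and (lt (.reg 11) (.reg 2)) (and
    (all 12 0 (imp (lt (.reg 12) (.reg 10))
      (imp (or (adjE 10 12) (ex 13 0 (and (adjE 13 12) (adjE 13 10))))
        (not (eq (labelE (bucketE 12)) (labelE (.reg 11)))))))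
    (and
      (all 12 0 (all 13 0 (all 14 0 (imp (lt (.reg 12) (.reg 10)) (imp (lt (.reg 13) (.reg 10))
        (imp (lt (.reg 14) (.reg 10)) (imp (adjE 10 12) (imp (adjE 13 14)
          (and
            (imp (eq (labelE (bucketE 14)) (labelE (bucketE 12)))
              (not (eq (bucketE 13) (.reg 11))))
            (imp (eq (bucketE 13) (bucketE 12))
              (not (eq (labelE (bucketE 14)) (labelE (.reg 11))))))))))))))
      (lt (count 12 0 (and (lt (.reg 12) (.reg 10)) (eq (bucketE 12) (.reg 11))))
        (add (.reg 1) (.reg 1)))))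

/-- The labels `b % L` of the buckets. -/
def labelCmd : Cmd :=
  .forLoop 10 0 (.store 4 (add (.reg 10) (.const 1)) (.const 0)
    (.ite (eq (add (labelE (.reg 10)) (.const 1)) (.reg 5)) (.const 0)
      (add (labelE (.reg 10)) (.const 1))))

/-- The powers of `3`. -/
def powerCmd : Cmd :=
  .seq (.store 6 (.const 0) (.const 0) (.const 1))
    (.forLoop 10 0 (.store 6 (add (.reg 10) (.const 1)) (.const 0)
      (smul 3 (.get 6 (.reg 10) (.const 0)))))

/-- The greedy choice of the buckets. -/
def greedyCmd : Cmd := .forLoop 10 0 (.store 5 (.reg 10) (.const 0) (first 15 11 0 fitsE))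

/-- The adjacency matrix of the source. -/
def sourceCmd : Cmd :=
  .table 1 10 0 11 0 (ex 12 0 (ex 13 0 (and (adjE 12 13)
    (and (eq (bucketE 12) (.reg 10)) (eq (bucketE 13) (.reg 11))))))

/-- The quotients `a / 3 ^ j`. -/
def quotientCmd : Cmd :=
  .table 7 10 3 11 0 (count 12 3 (le (succMul 13 3 12 (.get 6 (.reg 11) (.const 0))) (.reg 10)))

/-- The adjacency matrix of the target. -/
def targetCmd : Cmd :=
  .table 2 10 3 11 3 (and (lt (targetLabelE 10) (.reg 5)) (and (lt (targetLabelE 11) (.reg 5))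
    (not (eq (digitE 10 (targetLabelE 11)) (digitE 11 (targetLabelE 10))))))

/-- The incidence matrix of the lists. -/
def listCmd : Cmd :=
  .table 3 10 0 11 3 (and (eq (targetLabelE 11) (labelE (.reg 10)))
    (all 12 0 (all 13 0 (all 14 0 (imp (eq (bucketE 12) (.reg 10)) (imp (adjE 12 13)
      (imp (adjE 12 14) (eq (digitE 11 (labelE (bucketE 13)))
        (digitE 11 (labelE (bucketE 14)))))))))))

/-- The part of the program before the number of target vertices is known. -/
def firstPart : Cmd :=
  .seq (.assign 4 maxDegreeE) (.seq (.assign 5 labelCountE) (.seq (.assign 2 bucketCountE)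
    (.seq labelCmd (.seq powerCmd (.seq greedyCmd sourceCmd)))))

/-- The number `9 ^ L = 3 ^ (L + L)` of target vertices. -/
def targetCardE : SumExpr := .get 6 (add (.reg 5) (.reg 5)) (.const 0)

/-- The part of the program that works on the target. -/
def secondPart : Cmd := .seq quotientCmd (.seq targetCmd listCmd)

theorem firstPart_wf : firstPart.wf := by decide
theorem targetCardE_wf : targetCardE.wf := by decide
theorem secondPart_wf : secondPart.wf := by decide

/-! ### Correctness of the program -/

theorem exec_labelCmd {s : RamState} {L : ℕ} (hL : 0 < L) (h5 : s.reg 5 = L)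
    (h0 : s.arr 4 0 0 = 0) :
    s.SameBut 4 (labelCmd.exec s) ∧ ∀ b ≤ s.reg 0, (labelCmd.exec s).arr 4 b 0 = b % L := by
  refine Cmd.exec_forLoop_store s (fun m A => ∀ b ≤ m, A b 0 = b % L) le_rfl ?_ ?_
  · intro b hb
    obtain rfl : b = 0 := by omega
    simpa using h0
  · intro m hm s' hs hx hQ b hb
    have hlt := Nat.mod_lt m hL
    by_cases hbm : b = m + 1
    · have := hs.reg 5 (by omega)
      simp only [labelE, hbm, eval_add, eval_reg, eval_const, hx, hQ m le_rfl, this, h5, eval_ite,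
        holds_eq, eval_get, and_self, if_true]
      rw [Nat.add_mod_eq_ite]
      rcases Nat.lt_or_ge 1 L with h | h
      · rw [Nat.mod_eq_of_lt h]; split_ifs <;> omega
      · obtain rfl : L = 1 := by omega
        simp [Nat.mod_one]
    · simp [hx, hbm, hQ b (by omega)]

theorem exec_powerCmd (s : RamState) :
    s.SameBut 6 (powerCmd.exec s) ∧ ∀ j ≤ s.reg 0, (powerCmd.exec s).arr 6 j 0 = 3 ^ j := by
  have := Cmd.exec_forLoop_store (x := 10) (y := 0) (a := 6) (i := add (.reg 10) (.const 1))
    (j := .const 0) (e := smul 3 (.get 6 (.reg 10) (.const 0))) (s.setArr 6 0 0 1)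
    (fun m A => ∀ b ≤ m, A b 0 = 3 ^ b) le_rfl
    (by
      intro b hb
      obtain rfl : b = 0 := by omega
      simp)
    (by
      intro m hm s' hs hx hQ b hb
      by_cases hbm : b = m + 1
      · simp [hx, hbm, hQ m le_rfl, pow_succ']
      · simp [hx, hbm, hQ b (by omega)])
  refine ⟨⟨this.1.reg, fun b hb => ?_⟩, this.2⟩
  refine (this.1.arr b hb).trans ?_
  funext k l
  simp [hb]

/-- The memory holds the input graph, the parameters, and the labels of the buckets. -/
structure Prepared {n : ℕ} (G : SimpleGraph (Fin n)) (r k L : ℕ) (s : RamState) : Prop where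
  card : s.reg 0 = n
  param : s.reg 1 = r
  bucketCount : s.reg 2 = k
  labelCount : s.reg 5 = L
  adj : ∀ u v : Fin n, s.arr 0 u v ≠ 0 ↔ G.Adj u v
  label : ∀ b ≤ n, s.arr 4 b 0 = b % L

theorem Prepared.sameBut {n : ℕ} {G : SimpleGraph (Fin n)} {r k L : ℕ} {s s' : RamState}
    (h : Prepared G r k L s) {a : ℕ} (hs : s.SameBut a s') (h0 : a ≠ 0) (h4 : a ≠ 4) :
    Prepared G r k L s' where
  card := (hs.reg 0 (by omega)).trans h.card
  param := (hs.reg 1 (by omega)).trans h.param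
  bucketCount := (hs.reg 2 (by omega)).trans h.bucketCount
  labelCount := (hs.reg 5 (by omega)).trans h.labelCount
  adj := by rw [hs.arr 0 h0.symm]; exact h.adj
  label := by rw [hs.arr 4 h4.symm]; exact h.label

theorem holds_fitsE {n : ℕ} {G : SimpleGraph (Fin n)} {r k L : ℕ} {s : RamState}
    (h : Prepared G r k L s) (hk : k ≤ n) (x : Fin n) {b : ℕ} (hb : b < n) (h10 : s.reg 10 = x)
    (h11 : s.reg 11 = b) {B : Fin n → ℕ} (hB : ∀ u : Fin n, s.arr 5 u 0 = B u)
    (hBk : ∀ u < x, B u < k) :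
    fitsE.Holds s ↔ b < k ∧ Fits G L (r + r) {u | u < x} B x b := by
  have hlab : ∀ u < x, s.arr 4 (B u) 0 = B u % L := fun u hu =>
    h.label _ ((hBk u hu).le.trans hk)
  simp only [fitsE, adjE, bucketE, labelE, holds_and, holds_lt, holds_all, holds_imp, holds_or,
    holds_ex, holds_not, holds_eq, eval_get, eval_reg, eval_const, eval_add, holds_get, eval_count,
    reg_setReg, arr_setReg, h.card, h.param, h.bucketCount, h10, h11, h.label b hb.le,
    Nat.reduceEqDiff, if_true, if_false, OfNat.zero_ne_ofNat]
  have hex : ∀ w : Fin n, (∃ i < n, s.arr 0 i w ≠ 0 ∧ s.arr 0 i x ≠ 0) ↔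
      ∃ z, G.Adj z w ∧ G.Adj z x := fun w =>
    ⟨fun ⟨i, hi, h₁, h₂⟩ => ⟨⟨i, hi⟩, (h.adj ⟨i, hi⟩ w).1 h₁, (h.adj ⟨i, hi⟩ x).1 h₂⟩,
      fun ⟨z, h₁, h₂⟩ => ⟨z, z.2, (h.adj z w).2 h₁, (h.adj z x).2 h₂⟩⟩
  have hload : ((Finset.range n).filter fun u : ℕ => u < (x : ℕ) ∧ s.arr 5 u 0 = b).card =
      {u ∈ {u | u < x} | B u = b}.ncard := by
    classical
    have : {u ∈ {u | u < x} | B u = b} =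
        ((Finset.univ.filter fun u : Fin n => u < x ∧ B u = b : Finset (Fin n)) : Set (Fin n)) := by
      ext u
      simp
    rw [this, Set.ncard_coe_finset, Finset.card_filter, Finset.card_filter, Finset.sum_range]
    simp only [hB, Fin.val_fin_lt]
  simp only [Nat.forall_lt_iff_fin, h.adj, hB, hex, Fin.val_fin_lt, hload]
  refine and_congr_right fun _ => ⟨fun ⟨h₁, h₂, h₃⟩ => ⟨fun w hw hxw => ?_,
    fun w hw u hu v hv hxw huv => ?_, h₃⟩, fun H => ⟨fun w hw hxw => ?_,
    fun w u v hw hu hv hxw huv => ?_, H.load⟩⟩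
  · simpa only [hlab w hw] using h₁ w hw hxw
  · simpa only [hlab w hw, hlab v hv] using h₂ w u v hw hu hv hxw huv
  · simpa only [hlab w hw] using H.near w hw hxw
  · simpa only [hlab w hw, hlab v hv] using H.edge w hw u hu v hv hxw huv

theorem exec_greedyCmd {n : ℕ} {G : SimpleGraph (Fin n)} [DecidableRel G.Adj] {r k L D : ℕ}
    {s : RamState} (h : Prepared G r k L s) (hkn : k ≤ n) (hr : 1 ≤ r) (hL : 0 < L)
    (hD : ∀ v, G.degree v ≤ D)
    (hk : (D + D * D + 2 * (D * D * (r + r))) * (k / L + 1) + n / (r + r) < k) :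
    s.SameBut 5 (greedyCmd.exec s) ∧
      IsGrouping G L (r + r) Set.univ (fun u : Fin n => (greedyCmd.exec s).arr 5 u 0) ∧
      ∀ u : Fin n, (greedyCmd.exec s).arr 5 u 0 < k := by
  obtain ⟨hs, hg, hb⟩ := Cmd.exec_forLoop_store (x := 10) (y := 0) (a := 5) (i := .reg 10)
    (j := .const 0) (e := first 15 11 0 fitsE) s
    (fun m A => IsGrouping G L (r + r) {u : Fin n | u < m} (fun u : Fin n => A u 0) ∧
      ∀ u : Fin n, u < m → A u 0 < k) le_rfl
    ⟨⟨by simp, by simp, by simp, by simp⟩, by simp⟩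
    (by
      rintro m hm s' hs hx ⟨hg, hb⟩
      have hp := h.sameBut hs (by omega) (by omega)
      rw [h.card] at hm
      let x : Fin n := ⟨m, hm⟩
      have hfit : (first 15 11 0 fitsE).eval s' < k ∧
          Fits G L (r + r) {u | u < x} (fun u : Fin n => s'.arr 5 u 0) x
            ((first 15 11 0 fitsE).eval s') := by
        refine eval_first (p := fun b => b < k ∧ Fits G L (r + r) {u | u < x}
          (fun u : Fin n => s'.arr 5 u 0) x b) (by omega) (by omega) (fun i j hj => ?_) ?_
        · rw [hp.card] at hj
          exact holds_fitsE (s := (s'.setReg 15 i).setReg 11 j) ⟨hp.card, hp.param, hp.bucketCount, hp.labelCount,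
            hp.adj, hp.label⟩ hkn x hj hx rfl (fun _ => rfl) hb
        · obtain ⟨b, hbk, hfit⟩ := hg.exists_fits hb hD hL (by omega)
            (by simpa using hk) x
          exact ⟨b, by rw [hp.card]; omega, hbk, hfit⟩
      have hins : {u : Fin n | (u : ℕ) < m + 1} = insert x {u : Fin n | (u : ℕ) < m} := by
        ext u
        simp only [Set.mem_ofPred_eq, Set.mem_insert_iff, Fin.ext_iff, x]
        omega
      refine ⟨?_, fun u hu => ?_⟩
      · rw [hins]
        refine hg.insert (x := x) (by simp [x]) hfit.2 (by simp [hx, x]) fun u hu => ?_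
        have : (u : ℕ) ≠ m := hu.ne
        simp [hx, this]
      · by_cases hum : (u : ℕ) = m
        · simpa [hx, hum] using hfit.1
        · simpa [hx, hum] using hb u (by omega))
  rw [h.card] at hg hb
  have huniv : {u : Fin n | (u : ℕ) < n} = Set.univ := Set.eq_univ_of_forall fun u => u.2
  rw [huniv] at hg
  exact ⟨hs, hg, fun u => hb u u.2⟩

section Input

variable {n : ℕ} {G : SimpleGraph (Fin n)} [DecidableRel G.Adj] {r : ℕ}

theorem inputState_arr (u v : Fin n) :
    (inputState G r).arr 0 u v = if G.Adj u v then 1 else 0 := by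
  simp [inputState]

theorem eval_maxDegreeE (hn : 0 < n) : maxDegreeE.eval (inputState G r) = G.maxDegree := by
  classical
  have : Nonempty (Fin n) := ⟨⟨0, hn⟩⟩
  have hdeg : ∀ u : Fin n, ∑ i ∈ Finset.range n, (inputState G r).arr 0 u i = G.degree u := by
    intro u
    rw [Finset.sum_range]
    simp [inputState_arr, ← G.card_neighborFinset_eq_degree, G.neighborFinset_eq_filter]
  have h0 : (inputState G r).reg 0 = n := rfl
  simp only [maxDegreeE, adjE, eval_count, holds_ex, holds_lt, eval_sum, eval_reg, eval_get,
    reg_setReg, arr_setReg, Nat.reduceEqDiff, if_true, if_false, OfNat.zero_ne_ofNat, h0]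
  have : (Finset.range n).filter (fun i => ∃ u < n,
      i < ∑ j ∈ Finset.range n, (inputState G r).arr 0 u j) = Finset.range G.maxDegree := by
    ext i
    simp only [Finset.mem_filter, Finset.mem_range]
    constructor
    · rintro ⟨-, u, hu, hi⟩
      rw [hdeg ⟨u, hu⟩] at hi
      exact hi.trans_le (G.degree_le_maxDegree _)
    · intro hi
      obtain ⟨u, hu⟩ := G.exists_maximal_degree_vertex
      have hlt : G.maxDegree < n := by simpa using G.maxDegree_lt_card_verts
      exact ⟨hi.trans hlt, u, u.2, by rw [hdeg u]; omega⟩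
  rw [this, Finset.card_range]

theorem eval_labelCountE {s : RamState} {D : ℕ} (h4 : s.reg 4 = D) (h0 : D < s.reg 0)
    (h1 : s.reg 1 = r) : labelCountE.eval s = labelCount D r := by
  have h : ∀ i, (succMul 11 0 4 (.reg 1)).eval (s.setReg 12 i) = (D + 1) * r := fun i => by
    rw [eval_succMul (v := r) (by omega) (by simp [h1]) (by simpa [h4] using h0)]
    simp [h4]
  rw [labelCountE, eval_smul, eval_succMul (by omega) h (by omega), h4, labelCount]
  ring

theorem eval_bucketCountE {s : RamState} (h0 : s.reg 0 = n) (h1 : s.reg 1 = r) (hr : 1 ≤ r)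
    (hrn : r ≤ n) : bucketCountE.eval s = n / r := by
  classical
  rw [← Nat.card_filter_succ_mul_le (n := n) hr (Nat.div_le_self n r)]
  simp only [bucketCountE, eval_count, holds_le, eval_sum, eval_ite, holds_lt, eval_reg, eval_add,
    eval_const, reg_setReg, Nat.reduceEqDiff, if_true, if_false, OfNat.zero_ne_ofNat,
    OfNat.one_ne_ofNat, h0, h1]
  congr 1
  refine Finset.filter_congr fun i _ => ?_
  have : (Finset.range n).filter (fun j => j < r) = Finset.range r := by
    ext j
    simp only [Finset.mem_filter, Finset.mem_range]
    omega
  rw [← Finset.sum_filter, this]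
  simp [mul_comm]

end Input

theorem RamState.SameBut.setReg {a : ℕ} {s s' : RamState} (h : s.SameBut a s') {x : ℕ}
    (hx : 10 ≤ x) (v : ℕ) : s.SameBut a (s'.setReg x v) :=
  ⟨fun z hz => by simp [h.reg z hz, (hz.trans_le hx).ne], h.arr⟩

theorem Prepared.exists_iff {n : ℕ} {G : SimpleGraph (Fin n)} {r k L : ℕ} {s : RamState}
    (h : Prepared G r k L s) (i j : ℕ) :
    (∃ u < n, ∃ v < n, s.arr 0 u v ≠ 0 ∧ s.arr 5 u 0 = i ∧ s.arr 5 v 0 = j) ↔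
      ∃ u v : Fin n, G.Adj u v ∧ s.arr 5 u 0 = i ∧ s.arr 5 v 0 = j :=
  ⟨fun ⟨u, hu, v, hv, huv, H⟩ => ⟨⟨u, hu⟩, ⟨v, hv⟩, (h.adj ⟨u, hu⟩ ⟨v, hv⟩).1 huv, H⟩,
    fun ⟨u, v, huv, H⟩ => ⟨u, u.2, v, v.2, (h.adj u v).2 huv, H⟩⟩

theorem exec_sourceCmd {n : ℕ} {G : SimpleGraph (Fin n)} {r k L : ℕ} {s : RamState}
    (h : Prepared G r k L s) :
    s.SameBut 1 (sourceCmd.exec s) ∧ ∀ i < n, ∀ j < n, ((sourceCmd.exec s).arr 1 i j ≠ 0 ↔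
      ∃ u v : Fin n, G.Adj u v ∧ s.arr 5 u 0 = i ∧ s.arr 5 v 0 = j) := by
  have := Cmd.exec_table (a := 1) (x := 10) (y := 0) (x' := 11) (y' := 0)
    (e := ex 12 0 (ex 13 0 (and (adjE 12 13)
      (and (eq (bucketE 12) (.reg 10)) (eq (bucketE 13) (.reg 11)))))) s le_rfl (by omega)
    (by omega) (by omega)
    (fun i j v => v ≠ 0 ↔ ∃ u v : Fin n, G.Adj u v ∧ s.arr 5 u 0 = i ∧ s.arr 5 v 0 = j)
    (by
      intro i hi j hj s' hs hx hx'
      have hp := h.sameBut hs (by omega) (by omega)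
      refine Iff.trans (show _ ↔ _ from holds_ex s' _ 12 0) ?_
      rw [← h.exists_iff, ← hs.arr 0 (by omega), ← hs.arr 5 (by omega)]
      simp only [adjE, bucketE, holds_ex, holds_and, holds_eq, holds_get, eval_get, eval_reg,
        eval_const, reg_setReg, arr_setReg, Nat.reduceEqDiff, if_true, if_false,
        OfNat.zero_ne_ofNat, hp.card, hx, hx'])
  rwa [h.card] at this

/-- The memory after the first part of the program. -/
structure Grouped {n : ℕ} (G : SimpleGraph (Fin n)) (r k L : ℕ) (s : RamState) : Prop extends
    Prepared G r k L s where
  grouping : IsGrouping G L (r + r) Set.univ (fun u : Fin n => s.arr 5 u 0)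
  bucket_lt : ∀ u : Fin n, s.arr 5 u 0 < k
  source : ∀ i < n, ∀ j < n, (s.arr 1 i j ≠ 0 ↔
    ∃ u v : Fin n, G.Adj u v ∧ s.arr 5 u 0 = i ∧ s.arr 5 v 0 = j)

theorem Grouped.sameBut {n : ℕ} {G : SimpleGraph (Fin n)} {r k L : ℕ} {s s' : RamState}
    (h : Grouped G r k L s) {a : ℕ} (hs : s.SameBut a s') (h0 : a ≠ 0) (h1 : a ≠ 1) (h4 : a ≠ 4)
    (h5 : a ≠ 5) : Grouped G r k L s' where
  toPrepared := h.toPrepared.sameBut hs h0 h4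
  grouping := by rw [hs.arr 5 h5.symm]; exact h.grouping
  bucket_lt := by rw [hs.arr 5 h5.symm]; exact h.bucket_lt
  source := by rw [hs.arr 5 h5.symm, hs.arr 1 h1.symm]; exact h.source

section FirstPart

variable {n : ℕ} {G : SimpleGraph (Fin n)} [DecidableRel G.Adj] {r : ℕ}

theorem exec_firstPart (hr : 1 ≤ r) (hn : 64 * ((G.maxDegree + 1) * r) ^ 2 ≤ n) :
    Grouped G r (n / r) (labelCount G.maxDegree r) (firstPart.exec (inputState G r)) ∧
      ∀ j ≤ n, (firstPart.exec (inputState G r)).arr 6 j 0 = 3 ^ j := by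
  have hle : (G.maxDegree + 1) * r ≤ n := by nlinarith [Nat.zero_le ((G.maxDegree + 1) * r)]
  have hDn : G.maxDegree < n := by nlinarith
  have hrn : r ≤ n := by nlinarith
  have hLpos : 0 < labelCount G.maxDegree r := by unfold labelCount; positivity
  let s₁ := (Cmd.assign 4 maxDegreeE).exec (inputState G r)
  let s₂ := (Cmd.assign 5 labelCountE).exec s₁
  let s₃ := (Cmd.assign 2 bucketCountE).exec s₂
  have h₁ : s₁ = (inputState G r).setReg 4 G.maxDegree := by
    simp only [s₁, Cmd.exec, eval_maxDegreeE (G := G) (r := r) (by omega : 0 < n)]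
  have h₂ : s₂ = s₁.setReg 5 (labelCount G.maxDegree r) := by
    simp only [s₂, Cmd.exec]
    rw [eval_labelCountE (D := G.maxDegree) (r := r)] <;> simp [h₁, inputState, hDn]
  have h₃ : s₃ = s₂.setReg 2 (n / r) := by
    simp only [s₃, Cmd.exec]
    rw [eval_bucketCountE (n := n) (r := r) _ _ hr hrn] <;> simp [h₂, h₁, inputState]
  have hreg : s₃.reg 0 = n ∧ s₃.reg 1 = r ∧ s₃.reg 2 = n / r ∧
      s₃.reg 5 = labelCount G.maxDegree r := by
    refine ⟨?_, ?_, ?_, ?_⟩ <;> simp [h₃, h₂, h₁, inputState]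
  have harr : s₃.arr = (inputState G r).arr := by simp [h₃, h₂, h₁]
  obtain ⟨hs₄, hl⟩ := exec_labelCmd hLpos hreg.2.2.2 (by simp [harr, inputState])
  have hp₄ : Prepared G r (n / r) (labelCount G.maxDegree r) (labelCmd.exec s₃) :=
    ⟨(hs₄.reg 0 (by omega)).trans hreg.1, (hs₄.reg 1 (by omega)).trans hreg.2.1,
      (hs₄.reg 2 (by omega)).trans hreg.2.2.1, (hs₄.reg 5 (by omega)).trans hreg.2.2.2,
      fun u v => by rw [hs₄.arr 0 (by omega), harr, inputState_arr]; simp,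
      by rwa [hreg.1] at hl⟩
  obtain ⟨hs₅, hpow⟩ := exec_powerCmd (labelCmd.exec s₃)
  have hp₅ := hp₄.sameBut hs₅ (by omega) (by omega)
  obtain ⟨hs₆, hg, hb⟩ := exec_greedyCmd hp₅ (Nat.div_le_self n r) hr hLpos G.degree_le_maxDegree
    (bucket_count_lt hr hn)
  have hp₆ := hp₅.sameBut hs₆ (by omega) (by omega)
  obtain ⟨hs₇, hsrc⟩ := exec_sourceCmd hp₆
  have hp₇ := hp₆.sameBut hs₇ (by omega) (by omega)
  rw [hp₄.card] at hpow
  refine ⟨⟨hp₇, ?_, ?_, ?_⟩, fun j hj => ?_⟩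
  · change IsGrouping _ _ _ _ fun u : Fin n => (sourceCmd.exec _).arr 5 u 0
    rw [hs₇.arr 5 (by omega)]
    exact hg
  · change ∀ u : Fin n, (sourceCmd.exec _).arr 5 u 0 < _
    rw [hs₇.arr 5 (by omega)]
    exact hb
  · change ∀ i < n, ∀ j < n, ((sourceCmd.exec _).arr 1 i j ≠ 0 ↔
      ∃ u v : Fin n, G.Adj u v ∧ (sourceCmd.exec _).arr 5 u 0 = i ∧
        (sourceCmd.exec _).arr 5 v 0 = j)
    rw [hs₇.arr 5 (by omega)]
    exact hsrc
  · change (sourceCmd.exec _).arr 6 j 0 = _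
    rw [hs₇.arr 6 (by omega), hs₆.arr 6 (by omega)]
    exact hpow j hj

end FirstPart

theorem exec_quotientCmd {n : ℕ} {s : RamState} (h0 : s.reg 0 = n)
    (hpow : ∀ j ≤ n, s.arr 6 j 0 = 3 ^ j) :
    s.SameBut 7 (quotientCmd.exec s) ∧
      ∀ a < s.reg 3, ∀ j < n, (quotientCmd.exec s).arr 7 a j = a / 3 ^ j := by
  have := Cmd.exec_table (a := 7) (x := 10) (y := 3) (x' := 11) (y' := 0)
    (e := count 12 3 (le (succMul 13 3 12 (.get 6 (.reg 11) (.const 0))) (.reg 10))) s le_rfl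
    (by omega) (by omega) (by omega) (fun a j v => v = a / 3 ^ j)
    (by
      classical
      intro a ha j hj s' hs hx hx'
      rw [h0] at hj
      have h3 := hs.reg 3 (by omega)
      rw [← Nat.card_filter_succ_mul_le (n := s.reg 3) (by positivity)
        ((Nat.div_le_self _ _).trans ha.le), eval_count, h3]
      congr 1
      refine Finset.filter_congr fun i hi => ?_
      rw [holds_le, eval_succMul (v := 3 ^ j) (by omega)
        (fun t => by simp [hs.arr, hx', hpow j hj.le])
        (by simpa [h3] using hi)]
      simp [hx])
  rwa [h0] at this

theorem ternaryDigit_eq_sub (a j : ℕ) : ternaryDigit a j = a / 3 ^ j - 3 * (a / 3 ^ (j + 1)) := by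
  rw [ternaryDigit, pow_succ, ← Nat.div_div_eq_div_mul]
  omega

/-- The memory after the table of quotients has been computed. -/
structure Tabulated {n : ℕ} (G : SimpleGraph (Fin n)) (r k L : ℕ) (s : RamState) : Prop extends
    Grouped G r k L s where
  targetCard : s.reg 3 = 9 ^ L
  quotient : ∀ a < 9 ^ L, ∀ j ≤ L, s.arr 7 a j = a / 3 ^ j

section SecondPart

variable {n : ℕ} {G : SimpleGraph (Fin n)} {r k L : ℕ} {s : RamState}

theorem Tabulated.sameBut (h : Tabulated G r k L s) {s' : RamState} {a : ℕ} (hs : s.SameBut a s')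
    (ha : a = 2 ∨ a = 3) : Tabulated G r k L s' where
  toGrouped := h.toGrouped.sameBut hs (by omega) (by omega) (by omega) (by omega)
  targetCard := (hs.reg 3 (by omega)).trans h.targetCard
  quotient := by rw [hs.arr 7 (by omega)]; exact h.quotient

/-- Registers from `10` on are only loop counters. -/
theorem Tabulated.setReg (h : Tabulated G r k L s) {x : ℕ} (hx : 10 ≤ x) (v : ℕ) :
    Tabulated G r k L (s.setReg x v) :=
  h.sameBut (a := 2) ((⟨fun _ _ => rfl, fun _ _ => rfl⟩ : s.SameBut 2 s).setReg hx v) (.inl rfl)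

theorem Tabulated.eval_targetLabelE (h : Tabulated G r k L s) {x : ℕ} (hx : s.reg x < 9 ^ L) :
    (targetLabelE x).eval s = s.reg x / 3 ^ L := by
  simp only [targetLabelE, eval_get, eval_reg, h.labelCount, h.quotient _ hx L le_rfl]

theorem Tabulated.eval_digitE (h : Tabulated G r k L s) {x : ℕ} {e : SumExpr}
    (hx : s.reg x < 9 ^ L) (he : e.eval s < L) :
    (digitE x e).eval s = ternaryDigit (s.reg x) (e.eval s) := by
  simp only [digitE, eval_sub, eval_smul, eval_get, eval_reg, eval_add, eval_const,
    h.quotient _ hx _ he.le, h.quotient _ hx _ (Nat.succ_le_of_lt he), ternaryDigit_eq_sub]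

theorem Tabulated.eval_labelE (h : Tabulated G r k L s) (hk : k ≤ n) {x : ℕ}
    (hx : s.reg x < n) : (labelE (bucketE x)).eval s = s.arr 5 (s.reg x) 0 % L := by
  simp only [labelE, bucketE, eval_get, eval_reg, eval_const]
  exact h.label _ ((h.bucket_lt ⟨_, hx⟩).le.trans hk)

theorem exec_targetCmd (h : Tabulated G r k L s) :
    s.SameBut 2 (targetCmd.exec s) ∧ ∀ a < 9 ^ L, ∀ b < 9 ^ L, ((targetCmd.exec s).arr 2 a b ≠ 0 ↔
      a / 3 ^ L < L ∧ b / 3 ^ L < L ∧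
        ternaryDigit a (b / 3 ^ L) ≠ ternaryDigit b (a / 3 ^ L)) := by
  have := Cmd.exec_table (a := 2) (x := 10) (y := 3) (x' := 11) (y' := 3)
    (e := and (lt (targetLabelE 10) (.reg 5)) (and (lt (targetLabelE 11) (.reg 5))
      (not (eq (digitE 10 (targetLabelE 11)) (digitE 11 (targetLabelE 10)))))) s le_rfl
    (by omega) (by omega) (by omega)
    (fun a b v => v ≠ 0 ↔ a / 3 ^ L < L ∧ b / 3 ^ L < L ∧
        ternaryDigit a (b / 3 ^ L) ≠ ternaryDigit b (a / 3 ^ L))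
    (by
      intro a ha b hb s' hs hx hx'
      rw [h.targetCard] at ha hb
      rw [← hx] at ha
      rw [← hx'] at hb
      have ht := h.sameBut hs (.inl rfl)
      refine Iff.trans (show _ ↔ _ from holds_and s' _ _) ?_
      rw [← hx, ← hx', holds_and, holds_lt, holds_lt, ht.eval_targetLabelE ha,
        ht.eval_targetLabelE hb, eval_reg, ht.labelCount, holds_not, holds_eq]
      refine and_congr_right fun h₁ => and_congr_right fun h₂ => not_congr ?_
      rw [ht.eval_digitE ha (by rwa [ht.eval_targetLabelE hb]),
        ht.eval_digitE hb (by rwa [ht.eval_targetLabelE ha]), ht.eval_targetLabelE ha,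
        ht.eval_targetLabelE hb])
  rwa [h.targetCard] at this

theorem exec_listCmd (h : Tabulated G r k L s) (hk : k ≤ n) (hL : 0 < L) :
    s.SameBut 3 (listCmd.exec s) ∧ ∀ i < n, ∀ a < 9 ^ L, ((listCmd.exec s).arr 3 i a ≠ 0 ↔
      a / 3 ^ L = i % L ∧ ∀ u v w : Fin n, s.arr 5 u 0 = i → G.Adj u v → G.Adj u w →
        ternaryDigit a (s.arr 5 v 0 % L) = ternaryDigit a (s.arr 5 w 0 % L)) := by
  have := Cmd.exec_table (a := 3) (x := 10) (y := 0) (x' := 11) (y' := 3)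
    (e := and (eq (targetLabelE 11) (labelE (.reg 10)))
      (all 12 0 (all 13 0 (all 14 0 (imp (eq (bucketE 12) (.reg 10)) (imp (adjE 12 13)
        (imp (adjE 12 14) (eq (digitE 11 (labelE (bucketE 13)))
          (digitE 11 (labelE (bucketE 14)))))))))))
    s le_rfl (by omega) (by omega) (by omega)
    (fun i a v => v ≠ 0 ↔ a / 3 ^ L = i % L ∧ ∀ u v w : Fin n, s.arr 5 u 0 = i → G.Adj u v →
      G.Adj u w → ternaryDigit a (s.arr 5 v 0 % L) = ternaryDigit a (s.arr 5 w 0 % L))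
    (by
      intro i hi a ha s' hs hx hx'
      rw [h.card] at hi
      rw [h.targetCard] at ha
      have ht := h.sameBut hs (.inr rfl)
      refine Iff.trans (show _ ↔ _ from holds_and s' _ _) ?_
      rw [holds_eq, ht.eval_targetLabelE (by rwa [hx']), ← hs.arr 5 (by omega)]
      have hlab : (labelE (.reg 10)).eval s' = i % L := by
        simp only [labelE, eval_get, eval_reg, eval_const, hx, ht.label i hi.le]
      have hd : ∀ u v w : Fin n, ∀ z, z = 13 ∨ z = 14 →
          (digitE 11 (labelE (bucketE z))).eval (((s'.setReg 12 u).setReg 13 v).setReg 14 w) =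
            ternaryDigit a (s'.arr 5 (if z = 13 then v else w : Fin n) 0 % L) := by
        intro u v w z hz
        have ht' := ((ht.setReg (x := 12) (by omega) u).setReg (x := 13) (by omega) v).setReg
          (x := 14) (by omega) w
        have hz' : (((s'.setReg 12 u).setReg 13 v).setReg 14 w).reg z =
            ((if z = 13 then v else w : Fin n) : ℕ) := by
          rcases hz with rfl | rfl <;> simp
        have hl := ht'.eval_labelE hk (x := z) (by rw [hz']; exact Fin.is_lt _)
        rw [ht'.eval_digitE (by simpa [hx'] using ha) (by rw [hl]; exact Nat.mod_lt _ hL), hl, hz']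
        simp [hx']
      rw [hlab, hx']
      refine and_congr_right fun _ => ?_
      simp only [holds_all, holds_imp, holds_eq, reg_setReg, OfNat.zero_ne_ofNat, if_false,
        ht.card, Nat.forall_lt_iff_fin, hd _ _ _ 13 (.inl rfl), hd _ _ _ 14 (.inr rfl)]
      simp only [adjE, bucketE, holds_get, eval_get, eval_reg, eval_const, reg_setReg, arr_setReg,
        Nat.reduceEqDiff, if_true, if_false, hx, ht.adj])
  rwa [h.targetCard, h.card] at this

end SecondPart

/-! ### The reduction -/

theorem mainTheorem3 :
    ∃ (γ : ℕ → ℕ) (c : ℕ → ℝ) (P : RamProg) (p : Polynomial ℕ),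
      (∀ d, 0 < c d) ∧
      ∀ (d n r : ℕ) (G : SimpleGraph (Fin n)) [DecidableRel G.Adj],
        G.maxDegree ≤ d → 1 ≤ r → (r : ℝ) ≤ c d * Real.sqrt (n : ℝ) →
        ∃ (I : ListHomInstance) (t : ℕ) (s : RamState),
          P.Runs (inputState G r) t s ∧
          s.Holds I ∧
          t ≤ p.eval (n + I.tgtCard) ∧
          (G.Colorable 3 ↔ I.Satisfiable) ∧
          (I.srcCard : ℝ) ≤ (n : ℝ) / (r : ℝ) ∧
          I.tgtCard ≤ γ d ^ r := by
  refine ⟨fun d => 9 ^ (24 * ((d + 1) * (d + 1))), fun d => 1 / (8 * (d + 1)),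
    .seq firstPart.compile (.seq (Cmd.assign 3 targetCardE).compile secondPart.compile),
    firstPart.cost + (Cmd.assign 3 targetCardE).cost + secondPart.cost,
    fun d => by positivity, ?_⟩
  intro d n r G _ hd hr hrn
  -- The bound on `r`, squared and without square roots.
  have hn : 64 * ((G.maxDegree + 1) * r) ^ 2 ≤ n := by
    have h₁ : (8 * ((d + 1) * r) : ℝ) ≤ Real.sqrt n := by
      rw [div_mul_eq_mul_div, one_mul, le_div_iff₀ (by positivity)] at hrn
      linarith
    have h₂ := (Real.le_sqrt (by positivity) (by positivity)).1 h₁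
    have h₃ : 64 * ((d + 1) * r) ^ 2 ≤ n := by
      have : (8 * ((d + 1) * r) : ℝ) ^ 2 = ((64 * ((d + 1) * r) ^ 2 : ℕ) : ℝ) := by
        push_cast; ring
      rw [this] at h₂
      exact_mod_cast h₂
    refine le_trans ?_ h₃
    gcongr
  have h2L := two_mul_labelCount_le hr hn
  have hLpos : 0 < labelCount G.maxDegree r := by unfold labelCount; positivity
  obtain ⟨hg₁, hpow⟩ := exec_firstPart hr hn
  generalize hLdef : labelCount G.maxDegree r = L at *
  have hkn : n / r ≤ n := Nat.div_le_self n r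
  -- The memory as computed by the commands. Register `3` gets its value only between the two parts,
  -- as the loops of both parts need a fixed bound.
  let s₁ := firstPart.exec (inputState G r)
  let s₂ := (Cmd.assign 3 targetCardE).exec s₁
  have hs₂ : s₂ = s₁.setReg 3 (9 ^ L) := by
    have : s₁.reg 5 = L := hg₁.labelCount
    simp only [s₂, Cmd.exec, targetCardE, eval_get, eval_add, eval_reg, eval_const, this]
    rw [show s₁.arr 6 (L + L) 0 = 3 ^ (L + L) from hpow _ (by omega), pow_add, ← mul_pow]
    norm_num
  have h3 : s₂.reg 3 = 9 ^ L := by simp [hs₂]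
  have hg₂ : Grouped G r (n / r) L s₂ := by
    rw [hs₂]
    exact ⟨⟨hg₁.card, hg₁.param, hg₁.bucketCount, hg₁.labelCount, hg₁.adj, hg₁.label⟩,
      hg₁.grouping, hg₁.bucket_lt, hg₁.source⟩
  obtain ⟨hq, hquot⟩ := exec_quotientCmd hg₂.card (by rw [hs₂]; exact hpow)
  have ht₃ : Tabulated G r (n / r) L (quotientCmd.exec s₂) :=
    ⟨hg₂.sameBut hq (by omega) (by omega) (by omega) (by omega), (hq.reg 3 (by omega)).trans h3,
      fun a ha j hj => hquot a (by rwa [h3]) j (by omega)⟩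
  obtain ⟨hs₄, htgt⟩ := exec_targetCmd ht₃
  have ht₄ := ht₃.sameBut hs₄ (.inl rfl)
  obtain ⟨hs₅, hlist⟩ := exec_listCmd ht₄ hkn hLpos
  have ht₅ := ht₄.sameBut hs₅ (.inr rfl)
  let s₅ := secondPart.exec s₂
  -- The run of the compiled program.
  have h0N : (inputState G r).reg 0 ≤ n + 9 ^ L := Nat.le_add_right n _
  obtain ⟨t₁, m₁, hr₁, ha₁, hb₁⟩ := Cmd.compile_runs firstPart_wf (inputState G r) (inputState G r)
    (.refl 20 _) h0N (by simp [inputState])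
  have h3₁ : s₁.reg 3 = 0 :=
    Cmd.exec_reg_of_not_writes (Cmd.not_writes_bounds firstPart_wf).2 _
  obtain ⟨t₂, m₂, hr₂, ha₂, hb₂⟩ := Cmd.assign_runs targetCardE_wf (x := 3) s₁ m₁ ha₁
    (N := n + 9 ^ L) (hg₁.card.trans_le (Nat.le_add_right _ _)) (by omega)
  obtain ⟨t₃, m₃, hr₃, ha₃, hb₃⟩ := Cmd.compile_runs secondPart_wf s₂ m₂ ha₂
    (N := n + 9 ^ L) (hg₂.card.trans_le (Nat.le_add_right _ _)) (by omega)
  have hB : (quotientCmd.exec s₂).arr 5 = s₅.arr 5 := by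
    rw [← hs₄.arr 5 (by omega)]
    exact (hs₅.arr 5 (by omega)).symm
  refine ⟨groupingInstance G L (r + r) (n / r) (fun u => s₅.arr 5 u 0) ht₅.grouping,
    t₁ + (t₂ + t₃), m₃, .seq hr₁ (.seq hr₂ hr₃), ⟨?_, ?_, fun u v => ?_, fun a b => ?_,
      fun u a => ?_⟩, ?_, colorable_three_iff_satisfiable ht₅.grouping hLpos ht₅.bucket_lt, ?_, ?_⟩
  · exact (ha₃.reg 2 (by omega)).trans ht₅.bucketCount
  · exact (ha₃.reg 3 (by omega)).trans ht₅.targetCard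
  · rw [ha₃.arr]
    exact ht₅.source u (u.2.trans_le hkn) v (v.2.trans_le hkn)
  · rw [ha₃.arr]
    change (listCmd.exec _).arr 2 a b ≠ 0 ↔ _
    rw [hs₅.arr 2 (by omega)]
    exact htgt a a.2 b b.2
  · rw [ha₃.arr]
    refine (hlist u (u.2.trans_le hkn) a a.2).trans ?_
    rw [hs₄.arr 5 (by omega), hB]
    rfl
  · change _ ≤ Polynomial.eval (n + 9 ^ L) _
    simp only [Polynomial.eval_add]
    omega
  · exact Nat.cast_div_le
  · change 9 ^ L ≤ _
    rw [← hLdef, labelCount, ← pow_mul]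
    gcongr
    norm_num
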